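/- For a finite simple graph $G$ with $n\ge 1$ vertices and $e$ edges and a vertex $v$ of $G$, let $r(v)$ be the sum of the degrees of the neighbours of $v$. If $\deg(v)>0$, the vertex $v$ is called a groupie if the average degree of its neighbours is at least the average degree of all vertices of $G$, i.e. $\frac{r(v)}{\deg(v)}\ge\frac{2e}{n}$; if $\deg(v)=0$, then $v$ is called a groupie if and only if all vertices of $G$ are isolated. Theorem. Fix $p$ with $0<p<1$, let $B(n,p)$ be the random graph on $n$ labelled vertices in which each of the $\binom n2$ possible edges is present independently with probability $p$, and let $N(n)$ be the number of groupies in $B(n,p)$. Then for every $\epsilon>0$, $$P\left(\left|\frac{N(n)}{n}-\Phi(1)\right|>\epsilon\right)\to 0\quad\text{as } n\to\infty,$$ where $\Phi$ is the distribution function of the standard normal distribution $N(0,1)$; here $\Phi(1)\approx 0.8413$, correct to four decimal places. -/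

import Mathlib

open MeasureTheory ProbabilityTheory Filter Topology

namespace Groupie

/-- The sum `r(v)` of the degrees of the neighbours of `v`. -/
def neighborDegreeSum {V : Type*} [Fintype V] (G : SimpleGraph V) [DecidableRel G.Adj] (v : V) :
    ℕ :=
  ∑ w ∈ G.neighborFinset v, G.degree w

/-- A vertex `v` is a groupie if the average degree `r(v) / deg(v)` of its neighbours is at least
the average degree `2e / n` of all vertices of `G`; an isolated vertex is a groupie if and only if
all vertices of `G` are isolated. -/
def IsGroupie {V : Type*} [Fintype V] [DecidableEq V] (G : SimpleGraph V) [DecidableRel G.Adj]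
    (v : V) : Prop :=
  if G.degree v = 0 then ∀ w : V, G.degree w = 0
  else 2 * (G.edgeFinset.card : ℝ) / (Fintype.card V : ℝ) ≤
    (neighborDegreeSum G v : ℝ) / (G.degree v : ℝ)

open Classical in
/-- The number of groupies of `G`. -/
noncomputable def groupieCount {V : Type*} [Fintype V] (G : SimpleGraph V) : ℕ :=
  (Finset.univ.filter fun v : V => IsGroupie G v).card

end Groupie

/-- The cumulative distribution function of the standard normal distribution. -/
noncomputable def stdNormalCDF (x : ℝ) : ℝ :=
  cdf (gaussianReal 0 1) x

/-!
# The proportion of groupies in a binomial random graph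

Write `η x y` for the centred edge indicator (`centered`), `q = 1 - p`, `s x = ∑ y, η x y`.
Expanding the degrees in terms of `η` shows that, for a vertex `v` of positive degree,
`r(v) - 2 e deg(v) / n` equals `∑ x, η v x * s x` up to terms of order `√n`
(`neighborDegreeSum_sub_eq`). The diagonal part `∑ x, η v x ^ 2` of this bilinear sum contributes
the mean `n p q`; the rest has standard deviation about `n p q`. Hence, after division by `n p q`,
the quantity whose sign decides whether `v` is a groupie is asymptotically normal with mean `1` and
variance `1`, and a vertex is a groupie with probability tending to `Φ(1)`. The normalised quantity
`standardScore` is one minus that ratio, so that `v` is a groupie exactly when it is at most `1`.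

For the law of large numbers the joint law for two vertices `v ≠ u` is needed. Up to an error of
order `√n` in `L¹`, the two bilinear sums involve only the edges from `v` and `u` to the remaining
vertices and the edges among the remaining vertices (`mainSum`). Given the former, a linear
combination of the two sums is a linear form in the independent variables of the latter, with
coefficients of size `O(1 / n)`; the conditional characteristic function is therefore a product of
Bernoulli characteristic functions (`integral_prod_exp_centered`), each close to a Gaussian one, and
the sum of the squared coefficients concentrates around the deterministic value
`q / p * (s ^ 2 + t ^ 2)`. This gives `norm_integral_exp_mainSum_sub_le`: the joint characteristic
function tends to that of two independent Gaussians, uniformly in `v ≠ u`. All independence is used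
in the form of `integral_centered_smul_eq_zero`: `η a b` is orthogonal to every function of the
graph that does not depend on the edge `ab`.

Averaging the joint laws over all pairs `(v, u)` gives a single measure `pairLaw` on the plane, to
which Lévy's continuity theorem and the portmanteau theorem apply. Its masses of a half-plane and of
a quadrant are the first and second moments of `N(n) / n`, so these tend to `Φ(1)` and `Φ(1) ^ 2`,
and Chebyshev's inequality finishes the proof. The numerical value of `Φ(1)` comes from a Taylor
polynomial of `exp (-x ^ 2 / 2)` on `[0, 1]`.
-/

namespace Groupie

open SimpleGraph
open scoped symmDiff ENNReal

/-! ### Centred edge indicators and their moments -/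

section moments

variable {V : Type*}

instance [Countable V] : MeasurableSingletonClass (SimpleGraph V) where
  measurableSet_singleton G := by
    have h : ({G} : Set (SimpleGraph V)) = edgeSet ⁻¹' {G.edgeSet} := by
      ext H
      simp
    rw [h]
    exact measurable_edgeSet (measurableSet_singleton _)

open Classical in
/-- The centred indicator of the edge `xy`; it is `0`, not `-p`, on the diagonal. -/
noncomputable def centered (p : ℝ) (G : SimpleGraph V) (x y : V) : ℝ :=
  if x = y then 0 else (if G.Adj x y then 1 else 0) - p

section centered

variable (p : ℝ) (G : SimpleGraph V)

@[simp] lemma centered_self (x : V) : centered p G x x = 0 := by simp [centered]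

lemma centered_comm (x y : V) : centered p G x y = centered p G y x := by
  by_cases h : x = y
  · simp [h]
  · have h' : ¬ y = x := Ne.symm h
    simp only [centered, h, h', if_false]
    classical
    rw [if_congr (G.adj_comm x y) rfl rfl]

lemma centered_sq {x y : V} (h : x ≠ y) :
    centered p G x y ^ 2 = (1 - 2 * p) * centered p G x y + p * (1 - p) := by
  by_cases hG : G.Adj x y <;> simp [centered, h, hG] <;> ring

lemma abs_centered_le (hp0 : 0 ≤ p) (hp1 : p ≤ 1) (x y : V) : |centered p G x y| ≤ 1 := by
  unfold centered
  split_ifs <;> simp [abs_le] <;> constructor <;> linarith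

/-- `G ∆ edge a b` is `G` with the edge `ab` switched; this affects only the indicator of `ab`. -/
lemma centered_toggle {a b x y : V} (h : s(a, b) ≠ s(x, y)) :
    centered p (G ∆ edge a b) x y = centered p G x y := by
  have h1 : ¬ (edge a b).Adj x y := by
    rw [adj_edge]; simp [h]
  have h2 : (G ∆ edge a b).Adj x y ↔ G.Adj x y := by
    rw [symmDiff_def, sup_adj, sdiff_adj, sdiff_adj]
    tauto
  unfold centered
  classical
  rw [if_congr h2 rfl rfl]

end centered

variable {p : unitInterval}

lemma toggle_adj_self {a b : V} (h : a ≠ b) (G : SimpleGraph V) :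
    (G ∆ edge a b).Adj a b ↔ ¬ G.Adj a b := by
  have : (edge a b).Adj a b := by simp [adj_edge, h]
  rw [symmDiff_def, sup_adj, sdiff_adj, sdiff_adj]
  tauto

lemma centered_sq_le_one (G : SimpleGraph V) (x y : V) : centered p G x y ^ 2 ≤ 1 := by
  have := abs_centered_le p G p.2.1 p.2.2 x y
  rw [← sq_abs]
  exact pow_le_one₀ (abs_nonneg _) this

variable [Fintype V]

lemma binomialRandom_real_toggle {a b : V} (h : a ≠ b) {G : SimpleGraph V} (hG : ¬ G.Adj a b) :
    (p : ℝ) * (binomialRandom V p).real {G} =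
      (1 - p) * (binomialRandom V p).real {G ∆ edge a b} := by
  classical
  have hG' : G ∆ edge a b = G ⊔ edge a b := ((disjoint_edge G).2 hG).symmDiff_eq_sup
  have hc : (G ⊔ edge a b).edgeSet.ncard = G.edgeSet.ncard + 1 := by
    rw [edgeSet_sup, edgeSet_edge_of_ne h, Set.union_singleton,
      Set.ncard_insert_of_notMem (by simpa using hG)]
  have hle : (G ⊔ edge a b).edgeSet.ncard ≤ (Nat.card V).choose 2 := by
    rw [Nat.card_eq_fintype_card, ← Sym2.card_diagSet_compl, Fintype.card_eq_nat_card,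
      ← Nat.card_coe_set_eq, Nat.card_coe_set_eq, Nat.card_coe_set_eq]
    exact Set.ncard_le_ncard (edgeSet_subset_compl_diagSet _)
  rw [hG']
  simp only [measureReal_def, binomialRandom_singleton]
  rw [hc] at hle ⊢
  obtain ⟨k, hk⟩ := Nat.exists_eq_add_of_le hle
  rw [hk, show G.edgeSet.ncard + 1 + k - G.edgeSet.ncard = k + 1 by omega,
    show G.edgeSet.ncard + 1 + k - (G.edgeSet.ncard + 1) = k by omega]
  simp
  ring

lemma integral_eq_sum {E : Type*} [NormedAddCommGroup E] [NormedSpace ℝ E]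
    [CompleteSpace E]
    (F : SimpleGraph V → E) [Fintype (SimpleGraph V)] :
    ∫ G, F G ∂(binomialRandom V p) = ∑ G, (binomialRandom V p).real {G} • F G :=
  integral_fintype .of_finite

/-- A centred edge indicator is orthogonal to every function of the graph that does not depend on
that edge. The proof pairs each graph with the one in which the edge is switched. -/
theorem integral_centered_smul_eq_zero {E : Type*} [NormedAddCommGroup E] [NormedSpace ℝ E]
    [CompleteSpace E]
    {a b : V} (h : a ≠ b) {F : SimpleGraph V → E} (hF : ∀ G, F (G ∆ edge a b) = F G) :
    ∫ G, centered p G a b • F G ∂(binomialRandom V p) = 0 := by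
  classical
  rw [integral_eq_sum]
  have key : ∀ G : SimpleGraph V, ¬ G.Adj a b →
      (binomialRandom V p).real {G} • centered p G a b • F G +
      (binomialRandom V p).real {G ∆ edge a b} • centered p (G ∆ edge a b) a b •
        F (G ∆ edge a b) = 0 := by
    intro G hG
    have h1 := (toggle_adj_self h G).2 hG
    rw [hF, smul_smul, smul_smul, ← add_smul]
    have : (binomialRandom V p).real {G} * centered p G a b +
      (binomialRandom V p).real {G ∆ edge a b} * centered p (G ∆ edge a b) a b = 0 := by
      simp only [centered, h, hG, h1, if_true, if_false]
      linarith [binomialRandom_real_toggle (p := p) h hG]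
    rw [this, zero_smul]
  refine Finset.sum_involution (fun G _ => G ∆ edge a b) (fun G _ => ?_) (fun G _ _ hG => ?_)
    (fun _ _ => Finset.mem_univ _) (fun G _ => symmDiff_symmDiff_cancel_right _ _)
  · by_cases hG : G.Adj a b
    · have h1 : ¬ (G ∆ edge a b).Adj a b := by rw [toggle_adj_self h]; exact not_not.2 hG
      have := key _ h1
      rw [symmDiff_symmDiff_cancel_right] at this
      rw [add_comm]; exact this
    · exact key _ hG
  · have := toggle_adj_self h G
    rw [hG] at this
    tauto

lemma integral_centered_mul_eq_zero {a b : V} (h : a ≠ b) {F : SimpleGraph V → ℝ}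
    (hF : ∀ G, F (G ∆ edge a b) = F G) :
    ∫ G, centered p G a b * F G ∂(binomialRandom V p) = 0 :=
  integral_centered_smul_eq_zero h hF

lemma integral_centered_mul_centered_eq_zero {a b x y : V} (h : s(a, b) ≠ s(x, y)) :
    ∫ G, centered p G a b * centered p G x y ∂(binomialRandom V p) = 0 := by
  by_cases hab : a = b
  · simp [hab]
  · exact integral_centered_mul_eq_zero hab fun G => centered_toggle _ _ h

/-- The second moment of a sum of pairwise orthogonal, uniformly bounded random variables. -/
lemma integral_sq_sum_le {Ω ι : Type*} [MeasurableSpace Ω] [Finite Ω] [MeasurableSingletonClass Ω]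
    (μ : Measure Ω) [IsProbabilityMeasure μ] (s : Finset ι) (f : ι → Ω → ℝ) {c : ℝ}
    (hc : ∀ i ∈ s, ∀ ω, f i ω ^ 2 ≤ c)
    (h : ∀ i ∈ s, ∀ j ∈ s, i ≠ j → ∫ ω, f i ω * f j ω ∂μ = 0) :
    ∫ ω, (∑ i ∈ s, f i ω) ^ 2 ∂μ ≤ s.card * c := by
  classical
  have h1 : ∫ ω, (∑ i ∈ s, f i ω) ^ 2 ∂μ = ∑ i ∈ s, ∑ j ∈ s, ∫ ω, f i ω * f j ω ∂μ := by
    simp_rw [sq, Finset.sum_mul_sum]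
    rw [integral_finsetSum _ fun _ _ => .of_finite]
    exact Finset.sum_congr rfl fun _ _ => integral_finsetSum _ fun _ _ => .of_finite
  rw [h1, ← nsmul_eq_mul]
  refine Finset.sum_le_card_nsmul _ _ _ fun i hi => ?_
  rw [Finset.sum_eq_single_of_mem i hi fun j hj hji => h i hi j hj hji.symm]
  calc ∫ ω, f i ω * f i ω ∂μ ≤ ∫ _, c ∂μ :=
        integral_mono .of_finite .of_finite fun ω => by simpa [sq] using hc i hi ω
    _ = c := by simp

lemma sum_sum_eq_sum_lt {W : Type*} [LinearOrder W] {M : Type*} [AddCommMonoid M] (s : Finset W)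
    (f : W → W → M) :
    ∑ x ∈ s, ∑ y ∈ s, f x y =
      (∑ e ∈ (s ×ˢ s).filter (fun e => e.1 < e.2), (f e.1 e.2 + f e.2 e.1)) + ∑ x ∈ s, f x x := by
  have h1 : ∑ e ∈ (s ×ˢ s).filter (fun e => e.1 < e.2), f e.2 e.1 =
      ∑ e ∈ (s ×ˢ s).filter (fun e => e.2 < e.1), f e.1 e.2 := by
    refine Finset.sum_nbij' Prod.swap Prod.swap ?_ ?_ ?_ ?_ ?_ <;>
      simp +contextual [and_comm]
  have h2 : ∑ x ∈ s, f x x = ∑ e ∈ (s ×ˢ s).filter (fun e => e.1 = e.2), f e.1 e.2 := by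
    refine Finset.sum_nbij' (fun x => (x, x)) Prod.fst ?_ ?_ ?_ ?_ ?_ <;>
      simp +contextual
  rw [Finset.sum_add_distrib, h1, h2, ← Finset.sum_product', ← Finset.sum_union, ← Finset.sum_union]
  · refine Finset.sum_congr ?_ fun _ _ => rfl
    ext ⟨x, y⟩
    have := lt_trichotomy x y
    simp only [Finset.mem_product, Finset.mem_union, Finset.mem_filter]
    tauto
  · rw [Finset.disjoint_left]
    simp only [Finset.mem_union, Finset.mem_filter]
    rintro e (h | h) h'
    · exact h.2.ne h'.2
    · exact h.2.ne' h'.2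
  · rw [Finset.disjoint_left]
    simp only [Finset.mem_filter]
    exact fun e h h' => lt_asymm h.2 h'.2

/-- The sum of the centred indicators of the pairs containing `v`: the centred degree of `v`. -/
noncomputable def rowSum (p : ℝ) (G : SimpleGraph V) (v : V) : ℝ := ∑ x, centered p G v x

/-- The sum of all centred degrees: every pair of vertices is counted twice. -/
noncomputable def totalSum (p : ℝ) (G : SimpleGraph V) : ℝ := ∑ v, rowSum p G v

/-- The centred analogue of the number of common neighbours of `v` and `u`. -/
noncomputable def codegreeSum (p : ℝ) (G : SimpleGraph V) (v u : V) : ℝ :=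
  ∑ x, centered p G v x * centered p G u x

lemma integral_rowSum_sq_le (v : V) :
    ∫ G, rowSum p G v ^ 2 ∂(binomialRandom V p) ≤ Fintype.card V := by
  have := integral_sq_sum_le (binomialRandom V p) Finset.univ (fun x G => centered p G v x) (c := 1)
    (fun x _ G => centered_sq_le_one G v x)
    (fun x _ y _ hxy => integral_centered_mul_centered_eq_zero (by
      rw [Ne, Sym2.congr_right]; exact hxy))
  simpa [rowSum] using this

lemma integral_codegreeSum_sq_le {v u : V} (hvu : v ≠ u) :
    ∫ G, codegreeSum p G v u ^ 2 ∂(binomialRandom V p) ≤ Fintype.card V := by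
  have := integral_sq_sum_le (binomialRandom V p) Finset.univ
    (fun x G => centered p G v x * centered p G u x) (c := 1)
    (fun x _ G => by
      rw [mul_pow]
      exact mul_le_one₀ (centered_sq_le_one G v x) (sq_nonneg _) (centered_sq_le_one G u x))
    (fun x _ y _ hxy => by
      by_cases hvx : v = x
      · simp [hvx]
      by_cases hux : u = x
      · simp [hux]
      simp_rw [mul_assoc]
      refine integral_centered_mul_eq_zero hvx fun G => ?_
      rw [centered_toggle, centered_toggle, centered_toggle] <;> simp <;> tauto)
  simpa [codegreeSum] using this

lemma integral_totalSum_sq_le [LinearOrder V] :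
    ∫ G, totalSum p G ^ 2 ∂(binomialRandom V p) ≤ 4 * (Fintype.card V : ℝ) ^ 2 := by
  have := integral_sq_sum_le (binomialRandom V p)
    ((Finset.univ ×ˢ Finset.univ).filter fun e : V × V => e.1 < e.2)
    (fun e G => centered p G e.1 e.2 + centered p G e.2 e.1) (c := 4)
    (fun e _ G => by
      rw [centered_comm p G e.2]
      linarith [centered_sq_le_one (p := p) G e.1 e.2])
    (fun e he f hf hef => by
      simp only [Finset.mem_filter] at he hf
      have h0 : s(e.1, e.2) ≠ s(f.1, f.2) := by
        rw [Ne, Sym2.eq_iff]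
        rintro (h | h)
        · exact hef (Prod.ext h.1 h.2)
        · have h1 := he.2
          rw [h.1, h.2] at h1
          exact lt_asymm h1 hf.2
      have h1 := integral_centered_mul_centered_eq_zero (p := p) h0
      have : ∀ G, (centered p G e.1 e.2 + centered p G e.2 e.1) *
          (centered p G f.1 f.2 + centered p G f.2 f.1) =
          4 * (centered p G e.1 e.2 * centered p G f.1 f.2) := fun G => by
        rw [centered_comm p G e.2, centered_comm p G f.2]; ring
      simp_rw [this]
      rw [integral_const_mul, h1, mul_zero])
  have h2 : ∀ G : SimpleGraph V, totalSum p G =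
      ∑ e ∈ (Finset.univ ×ˢ Finset.univ).filter (fun e : V × V => e.1 < e.2),
        (centered p G e.1 e.2 + centered p G e.2 e.1) := fun G => by
    simp [totalSum, rowSum, sum_sum_eq_sum_lt]
  simp_rw [h2]
  refine this.trans ?_
  have hcard : ((Finset.univ ×ˢ Finset.univ).filter fun e : V × V => e.1 < e.2).card ≤
      Fintype.card V ^ 2 := by
    refine (Finset.card_filter_le _ _).trans ?_
    simp [sq]
  have : (((Finset.univ ×ˢ Finset.univ).filter fun e : V × V => e.1 < e.2).card : ℝ) ≤
      (Fintype.card V : ℝ) ^ 2 := by exact_mod_cast hcard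
  linarith

end moments

/-! ### Characteristic functions of linear forms in centred edge indicators -/

section charFun

/-- The characteristic function of a centred Bernoulli variable of parameter `p`. -/
noncomputable def bernoulliCharFun (p θ : ℝ) : ℂ :=
  p * Complex.exp ((θ * (1 - p) : ℝ) * Complex.I) +
    (1 - p : ℝ) * Complex.exp ((θ * (-p) : ℝ) * Complex.I)

lemma norm_bernoulliCharFun_le {p : ℝ} (hp0 : 0 ≤ p) (hp1 : p ≤ 1) (θ : ℝ) :
    ‖bernoulliCharFun p θ‖ ≤ 1 := by
  unfold bernoulliCharFun
  refine (norm_add_le _ _).trans ?_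
  rw [norm_mul, norm_mul, Complex.norm_exp_ofReal_mul_I, Complex.norm_exp_ofReal_mul_I,
    Complex.norm_real, Complex.norm_real, Real.norm_of_nonneg hp0,
    Real.norm_of_nonneg (by linarith)]
  linarith

lemma norm_exp_mul_I_sub_taylor_le {θ c : ℝ} (hθ : |θ| ≤ 1) (hc : |c| ≤ 1) :
    ‖Complex.exp ((θ * c : ℝ) * Complex.I) -
      (1 + (θ * c : ℝ) * Complex.I - ((θ * c : ℝ) : ℂ) ^ 2 / 2)‖ ≤ 3 * |θ| ^ 3 := by
  have h := Complex.norm_exp_sub_sum_le_norm_mul_exp ((θ * c : ℝ) * Complex.I) 3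
  have hx : ‖((θ * c : ℝ) : ℂ) * Complex.I‖ = |θ| * |c| := by
    rw [norm_mul, Complex.norm_I, mul_one, Complex.norm_real, Real.norm_eq_abs, abs_mul]
  have hx1 : |θ| * |c| ≤ |θ| := mul_le_of_le_one_right (abs_nonneg _) hc
  rw [hx] at h
  have hs : ∑ m ∈ Finset.range 3, (((θ * c : ℝ) : ℂ) * Complex.I) ^ m / (m.factorial : ℂ) =
      1 + (θ * c : ℝ) * Complex.I - ((θ * c : ℝ) : ℂ) ^ 2 / 2 := by
    simp [Finset.sum_range_succ, mul_pow]
    ring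
  rw [hs] at h
  refine h.trans ?_
  have he : Real.exp (|θ| * |c|) ≤ 3 :=
    (Real.exp_le_exp.2 (hx1.trans hθ)).trans (by linarith [Real.exp_one_lt_d9])
  calc (|θ| * |c|) ^ 3 * Real.exp (|θ| * |c|) ≤ |θ| ^ 3 * 3 := by gcongr
    _ = 3 * |θ| ^ 3 := by ring

lemma norm_bernoulliCharFun_sub_exp_le {p : ℝ} (hp0 : 0 ≤ p) (hp1 : p ≤ 1) (θ : ℝ) :
    ‖bernoulliCharFun p θ - Real.exp (-(p * (1 - p) / 2 * θ ^ 2))‖ ≤ 4 * |θ| ^ 3 := by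
  have hpq : 0 ≤ p * (1 - p) := mul_nonneg hp0 (by linarith)
  have hpq1 : p * (1 - p) ≤ 1 := by nlinarith
  rcases le_total |θ| 1 with hθ | hθ
  · have h1 := norm_exp_mul_I_sub_taylor_le (c := 1 - p) hθ
      (by rw [abs_le]; constructor <;> linarith)
    have h2 := norm_exp_mul_I_sub_taylor_le (c := -p) hθ (by rw [abs_le]; constructor <;> linarith)
    have hy1 : p * (1 - p) / 2 * θ ^ 2 ≤ θ ^ 2 := by nlinarith [sq_nonneg θ]
    have hy0 : 0 ≤ p * (1 - p) / 2 * θ ^ 2 := by positivity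
    have hsq : θ ^ 2 ≤ 1 := by rw [← sq_abs]; exact pow_le_one₀ (abs_nonneg _) hθ
    have h3 : ‖Real.exp (-(p * (1 - p) / 2 * θ ^ 2)) - 1 - -(p * (1 - p) / 2 * θ ^ 2)‖ ≤
        |θ| ^ 3 := by
      refine (Real.norm_exp_sub_one_sub_id_le ?_).trans ?_
      · rw [norm_neg, Real.norm_of_nonneg hy0]; linarith
      · rw [norm_neg, Real.norm_of_nonneg hy0]
        calc (p * (1 - p) / 2 * θ ^ 2) ^ 2 ≤ (θ ^ 2) ^ 2 := by gcongr
          _ = |θ| ^ 3 * |θ| := by rw [← sq_abs θ]; ring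
          _ ≤ |θ| ^ 3 := mul_le_of_le_one_right (by positivity) hθ
    have h3' : ‖((Real.exp (-(p * (1 - p) / 2 * θ ^ 2)) - 1 - -(p * (1 - p) / 2 * θ ^ 2) : ℝ) : ℂ)‖
        ≤ |θ| ^ 3 := by rwa [Complex.norm_real]
    set e1 := Complex.exp ((θ * (1 - p) : ℝ) * Complex.I) -
      (1 + (θ * (1 - p) : ℝ) * Complex.I - ((θ * (1 - p) : ℝ) : ℂ) ^ 2 / 2) with he1
    set e2 := Complex.exp ((θ * (-p) : ℝ) * Complex.I) -
      (1 + (θ * (-p) : ℝ) * Complex.I - ((θ * (-p) : ℝ) : ℂ) ^ 2 / 2) with he2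
    have key : bernoulliCharFun p θ - Real.exp (-(p * (1 - p) / 2 * θ ^ 2)) =
        (p : ℂ) * e1 + ((1 - p : ℝ) : ℂ) * e2 -
        ((Real.exp (-(p * (1 - p) / 2 * θ ^ 2)) - 1 - -(p * (1 - p) / 2 * θ ^ 2) : ℝ) : ℂ) := by
      rw [he1, he2, bernoulliCharFun]
      push_cast
      ring
    rw [key]
    refine (norm_sub_le _ _).trans ?_
    have h4 : ‖(p : ℂ) * e1 + ((1 - p : ℝ) : ℂ) * e2‖ ≤ 3 * |θ| ^ 3 := by
      refine (norm_add_le _ _).trans ?_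
      rw [norm_mul, norm_mul, Complex.norm_real, Complex.norm_real, Real.norm_of_nonneg hp0,
        Real.norm_of_nonneg (by linarith)]
      nlinarith
    linarith
  · refine (norm_sub_le _ _).trans ?_
    have h1 := norm_bernoulliCharFun_le hp0 hp1 θ
    have h2 : ‖(Real.exp (-(p * (1 - p) / 2 * θ ^ 2)) : ℂ)‖ ≤ 1 := by
      rw [Complex.norm_real, Real.norm_of_nonneg (Real.exp_nonneg _), Real.exp_le_one_iff]
      have : 0 ≤ p * (1 - p) / 2 * θ ^ 2 := by positivity
      linarith
    have h3 : 1 ≤ |θ| ^ 3 := one_le_pow₀ hθ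
    linarith

lemma norm_prod_sub_prod_le {ι : Type*} (s : Finset ι) (f g : ι → ℂ) (hf : ∀ i ∈ s, ‖f i‖ ≤ 1)
    (hg : ∀ i ∈ s, ‖g i‖ ≤ 1) :
    ‖∏ i ∈ s, f i - ∏ i ∈ s, g i‖ ≤ ∑ i ∈ s, ‖f i - g i‖ := by
  classical
  induction s using Finset.induction_on with
  | empty => simp
  | insert a s ha ih =>
    rw [Finset.prod_insert ha, Finset.prod_insert ha, Finset.sum_insert ha]
    have ih' := ih (fun i hi => hf i (Finset.mem_insert_of_mem hi))
      (fun i hi => hg i (Finset.mem_insert_of_mem hi))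
    have h1 : ‖∏ i ∈ s, f i‖ ≤ 1 := by
      rw [norm_prod]
      exact Finset.prod_le_one (fun _ _ => norm_nonneg _)
        fun i hi => hf i (Finset.mem_insert_of_mem hi)
    have h2 := hg a (Finset.mem_insert_self _ _)
    calc ‖f a * ∏ i ∈ s, f i - g a * ∏ i ∈ s, g i‖
        = ‖(f a - g a) * ∏ i ∈ s, f i + g a * (∏ i ∈ s, f i - ∏ i ∈ s, g i)‖ := by ring_nf
      _ ≤ ‖f a - g a‖ * ‖∏ i ∈ s, f i‖ + ‖g a‖ * ‖∏ i ∈ s, f i - ∏ i ∈ s, g i‖ := by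
        rw [← norm_mul, ← norm_mul]; exact norm_add_le _ _
      _ ≤ ‖f a - g a‖ * 1 + 1 * ∑ i ∈ s, ‖f i - g i‖ := by gcongr
      _ = _ := by ring

variable {V : Type*} {p : unitInterval}

/-- As a centred edge indicator takes two values, every function of it is affine in it, the constant
coefficient being the mean. -/
lemma exp_mul_centered (G : SimpleGraph V) {x y : V} (h : x ≠ y) (c : ℝ) :
    Complex.exp ((c * centered p G x y : ℝ) * Complex.I) = bernoulliCharFun p c +
      centered p G x y • (Complex.exp ((c * (1 - p) : ℝ) * Complex.I) -
        Complex.exp ((c * (-p) : ℝ) * Complex.I)) := by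
  rw [Complex.real_smul, bernoulliCharFun]
  by_cases hG : G.Adj x y <;> simp only [centered, h, hG, if_true, if_false] <;>
    push_cast <;> ring_nf

variable [Fintype V]

/-- Conditional independence: if the coefficients `c` and the factor `K` do not depend on the edges
in `T`, then those edges can be integrated out one at a time. -/
theorem integral_prod_exp_centered [LinearOrder V] (T : Finset (V × V)) (hT : ∀ e ∈ T, e.1 < e.2)
    (c : SimpleGraph V → V × V → ℝ) (K : SimpleGraph V → ℂ)
    (hc : ∀ e ∈ T, ∀ G, c (G ∆ edge e.1 e.2) = c G)
    (hK : ∀ e ∈ T, ∀ G, K (G ∆ edge e.1 e.2) = K G) :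
    ∫ G, K G * ∏ e ∈ T, Complex.exp ((c G e * centered p G e.1 e.2 : ℝ) * Complex.I)
        ∂(binomialRandom V p) =
      ∫ G, K G * ∏ e ∈ T, bernoulliCharFun p (c G e) ∂(binomialRandom V p) := by
  induction T using Finset.induction_on generalizing K with
  | empty => simp
  | insert a T ha ih =>
    have ha' : a.1 ≠ a.2 := (hT a (Finset.mem_insert_self _ _)).ne
    have hmem : ∀ e ∈ T, e ∈ insert a T := fun e he => Finset.mem_insert_of_mem he
    have hne : ∀ e ∈ T, s(a.1, a.2) ≠ s(e.1, e.2) := by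
      intro e he h
      rw [Sym2.eq_iff] at h
      rcases h with h | h
      · exact ha (by rwa [Prod.ext h.1 h.2])
      · have h1 := hT a (Finset.mem_insert_self _ _)
        have h2 := hT e (hmem e he)
        rw [h.1, h.2] at h1
        exact lt_asymm h1 h2
    have h1 : ∀ G : SimpleGraph V, K G * ∏ e ∈ insert a T,
          Complex.exp ((c G e * centered p G e.1 e.2 : ℝ) * Complex.I) =
        (K G * bernoulliCharFun p (c G a)) *
          ∏ e ∈ T, Complex.exp ((c G e * centered p G e.1 e.2 : ℝ) * Complex.I) +
        centered p G a.1 a.2 • (K G * (Complex.exp ((c G a * (1 - p) : ℝ) * Complex.I) -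
          Complex.exp ((c G a * (-p) : ℝ) * Complex.I)) *
          ∏ e ∈ T, Complex.exp ((c G e * centered p G e.1 e.2 : ℝ) * Complex.I)) := by
      intro G
      rw [Finset.prod_insert ha, exp_mul_centered G ha']
      simp only [Complex.real_smul]
      ring
    simp_rw [h1]
    rw [integral_add .of_finite .of_finite, integral_centered_smul_eq_zero ha', add_zero,
      ih (fun e he => hT e (hmem e he)) _ (fun e he => hc e (hmem e he))]
    · simp_rw [Finset.prod_insert ha, mul_assoc]
    · intro e he G
      rw [hc e (hmem e he), hK e (hmem e he)]
    · intro G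
      rw [hc a (Finset.mem_insert_self _ _), hK a (Finset.mem_insert_self _ _)]
      congr 1
      refine Finset.prod_congr rfl fun e he => ?_
      rw [centered_toggle _ _ (hne e he)]

/-- A linear form in the edges of `T`, with small coefficients that do not depend on these edges, is
conditionally close to a Gaussian with the same conditional variance. -/
lemma norm_integral_exp_sub_le [LinearOrder V] (T : Finset (V × V)) (hT : ∀ e ∈ T, e.1 < e.2)
    (c : SimpleGraph V → V × V → ℝ) (hc : ∀ e ∈ T, ∀ G, c (G ∆ edge e.1 e.2) = c G) {B : ℝ}
    (hB : ∀ G, ∀ e ∈ T, |c G e| ≤ B) :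
    ‖∫ G, Complex.exp ((∑ e ∈ T, c G e * centered p G e.1 e.2 : ℝ) * Complex.I)
        ∂(binomialRandom V p) -
      ∫ G, ((Real.exp (-(p * (1 - p) / 2 * ∑ e ∈ T, c G e ^ 2)) : ℝ) : ℂ) ∂(binomialRandom V p)‖ ≤
      T.card * (4 * B ^ 3) := by
  have hq : (0 : ℝ) ≤ 1 - p := by linarith [p.2.2]
  have h0 := integral_prod_exp_centered (p := p) T hT c (fun _ => 1) hc (fun _ _ _ => rfl)
  simp only [one_mul, ← Complex.exp_sum, ← Finset.sum_mul, ← Complex.ofReal_sum] at h0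
  rw [h0, ← integral_sub .of_finite .of_finite]
  refine (norm_integral_le_of_norm_le_const (C := T.card * (4 * B ^ 3))
    (.of_forall fun G => ?_)).trans
    (by simp)
  have h1 : ((Real.exp (-(p * (1 - p) / 2 * ∑ e ∈ T, c G e ^ 2)) : ℝ) : ℂ) =
      ∏ e ∈ T, ((Real.exp (-(p * (1 - p) / 2 * c G e ^ 2)) : ℝ) : ℂ) := by
    rw [← Complex.ofReal_prod, ← Real.exp_sum, Finset.sum_neg_distrib, Finset.mul_sum]
  rw [h1]
  refine (norm_prod_sub_prod_le _ _ _ (fun e _ => norm_bernoulliCharFun_le p.2.1 p.2.2 _)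
    fun e _ => ?_).trans ?_
  · rw [Complex.norm_real, Real.norm_of_nonneg (Real.exp_nonneg _), Real.exp_le_one_iff]
    have : 0 ≤ (p : ℝ) * (1 - p) / 2 * c G e ^ 2 := by
      have := p.2.1
      positivity
    linarith
  · rw [← nsmul_eq_mul]
    refine Finset.sum_le_card_nsmul _ _ _ fun e he => ?_
    refine (norm_bernoulliCharFun_sub_exp_le p.2.1 p.2.2 _).trans ?_
    have := hB G e he
    gcongr

end charFun

/-! ### Joint asymptotic normality of the bilinear sums of two vertices -/

section mainSum

lemma sum_lt_add_sq {W : Type*} [LinearOrder W] (s : Finset W) (b : W → ℝ) :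
    ∑ e ∈ (s ×ˢ s).filter (fun e => e.1 < e.2), (b e.1 + b e.2) ^ 2 =
      (s.card - 2) * ∑ x ∈ s, b x ^ 2 + (∑ x ∈ s, b x) ^ 2 := by
  have h := sum_sum_eq_sum_lt s fun x y => (b x + b y) ^ 2
  have h1 : ∑ x ∈ s, ∑ y ∈ s, (b x + b y) ^ 2 =
      2 * s.card * ∑ x ∈ s, b x ^ 2 + 2 * (∑ x ∈ s, b x) ^ 2 := by
    simp_rw [add_sq, Finset.sum_add_distrib, ← Finset.mul_sum, ← Finset.sum_mul, Finset.sum_const,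
      nsmul_eq_mul, ← Finset.mul_sum]
    ring
  have h2 : ∀ e : W × W, (b e.1 + b e.2) ^ 2 + (b e.2 + b e.1) ^ 2 = 2 * (b e.1 + b e.2) ^ 2 :=
    fun e => by ring
  have h3 : ∀ x, (b x + b x) ^ 2 = 4 * b x ^ 2 := fun x => by ring
  simp_rw [h2, h3, ← Finset.mul_sum] at h
  linarith

lemma integral_abs_le_sqrt {Ω : Type*} [MeasurableSpace Ω] [Finite Ω] [MeasurableSingletonClass Ω]
    (μ : Measure Ω) [IsProbabilityMeasure μ] {f : Ω → ℝ} {c : ℝ} (hc : 0 < c)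
    (h : ∫ ω, f ω ^ 2 ∂μ ≤ c) : ∫ ω, |f ω| ∂μ ≤ √c := by
  have hs : 0 < √c := Real.sqrt_pos.2 hc
  have hss : √c * √c = c := Real.mul_self_sqrt hc.le
  have h1 : ∀ ω, |f ω| ≤ (f ω ^ 2 / √c + √c) / 2 := by
    intro ω
    rw [le_div_iff₀ two_pos, div_add' _ _ _ hs.ne', le_div_iff₀ hs, ← sq_abs]
    nlinarith [sq_nonneg (|f ω| - √c)]
  calc ∫ ω, |f ω| ∂μ ≤ ∫ ω, (f ω ^ 2 / √c + √c) / 2 ∂μ :=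
        integral_mono .of_finite .of_finite h1
    _ = ((∫ ω, f ω ^ 2 ∂μ) / √c + √c) / 2 := by
        rw [integral_div, integral_add .of_finite .of_finite, integral_div]
        simp
    _ ≤ (c / √c + √c) / 2 := by gcongr
    _ = √c := by rw [Real.div_sqrt]; ring

lemma norm_exp_mul_I_sub_le (a b : ℝ) :
    ‖Complex.exp (a * Complex.I) - Complex.exp (b * Complex.I)‖ ≤ |a - b| := by
  have h : Complex.exp (a * Complex.I) - Complex.exp (b * Complex.I) =
      Complex.exp (b * Complex.I) * (Complex.exp (Complex.I * ((a - b : ℝ) : ℂ)) - 1) := by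
    rw [mul_sub, ← Complex.exp_add, mul_one]
    congr 2
    push_cast
    ring
  rw [h, norm_mul, Complex.norm_exp_ofReal_mul_I, one_mul]
  exact Real.norm_exp_I_mul_ofReal_sub_one_le

lemma abs_exp_neg_sub_le {a b : ℝ} (ha : 0 ≤ a) (hb : 0 ≤ b) :
    |Real.exp (-a) - Real.exp (-b)| ≤ |a - b| := by
  wlog hab : a ≤ b generalizing a b
  · rw [abs_sub_comm, abs_sub_comm a]
    exact this hb ha (le_of_not_ge hab)
  rw [abs_of_nonneg (sub_nonneg.2 (Real.exp_le_exp.2 (by linarith))), abs_sub_comm,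
    abs_of_nonneg (by linarith)]
  have h1 : Real.exp (-b) = Real.exp (-a) * Real.exp (a - b) := by rw [← Real.exp_add]; ring_nf
  have h2 := Real.add_one_le_exp (a - b)
  have h3 : Real.exp (-a) ≤ 1 := Real.exp_le_one_iff.2 (by linarith)
  rw [h1]
  nlinarith [Real.exp_nonneg (-a)]

variable {V : Type*} [Fintype V]

/-- The part of `∑ x, ∑ y, η v x * η x y` in which neither `x` nor `y` lies in `{v, u}`. -/
noncomputable def mainSum [DecidableEq V] (p : ℝ) (G : SimpleGraph V) (v u : V) : ℝ :=
  ∑ x ∈ ({v, u} : Finset V)ᶜ, ∑ y ∈ ({v, u} : Finset V)ᶜ, centered p G v x * centered p G x y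

lemma sum_compl_pair [DecidableEq V] {v u : V} (h : v ≠ u) (f : V → ℝ) :
    ∑ x ∈ ({v, u} : Finset V)ᶜ, f x = ∑ x, f x - f v - f u := by
  have := Finset.sum_compl_add_sum ({v, u} : Finset V) f
  rw [Finset.sum_pair h] at this
  linarith

lemma sum_centered_sq (p : ℝ) (G : SimpleGraph V) (v : V) :
    ∑ x, centered p G v x ^ 2 =
      (1 - 2 * p) * rowSum p G v + (Fintype.card V - 1) * (p * (1 - p)) := by
  classical
  have h : ∀ x, centered p G v x ^ 2 =
      (1 - 2 * p) * centered p G v x + (p * (1 - p) - if v = x then p * (1 - p) else 0) := by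
    intro x
    by_cases hx : v = x
    · simp [hx]
    · rw [centered_sq p G hx]; simp [hx]
  simp_rw [h, Finset.sum_add_distrib, Finset.sum_sub_distrib, ← Finset.mul_sum, rowSum]
  simp
  ring

/-- The terms with `y = v` give the sum of squares, those with `x = u` or `y = u` the terms with
`centered p G v u` and `codegreeSum`. -/
lemma sum_centered_mul_rowSum [DecidableEq V] (p : ℝ) (G : SimpleGraph V) {v u : V} (h : v ≠ u) :
    ∑ x, centered p G v x * rowSum p G x =
      mainSum p G v u + centered p G v u * (rowSum p G u - centered p G v u) +
        codegreeSum p G v u + (1 - 2 * p) * rowSum p G v +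
        (Fintype.card V - 1) * (p * (1 - p)) := by
  have h1 : ∀ x, ∑ y ∈ ({v, u} : Finset V)ᶜ, centered p G v x * centered p G x y =
      centered p G v x * rowSum p G x - centered p G v x ^ 2 -
        centered p G v x * centered p G u x := by
    intro x
    rw [sum_compl_pair h, ← Finset.mul_sum, centered_comm p G x v, centered_comm p G x u, rowSum]
    ring
  have h2 := sum_centered_sq p G v
  unfold mainSum
  simp_rw [h1]
  rw [sum_compl_pair h, Finset.sum_sub_distrib, Finset.sum_sub_distrib, h2]
  simp only [centered_self, codegreeSum]
  ring

variable {p : unitInterval}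

/-- The conditional variance of a combination of two main sums, minus its limit. Here `a` and `a'`
stand for the centred degrees of `v` and `u`, `C` for their `codegreeSum`, and `e` for the indicator of
`vu`. -/
lemma abs_quadratic_sub_le {n p : ℝ} (hn : 2 ≤ n) (hp0 : 0 < p) (hp1 : p ≤ 1)
    (s t a a' C : ℝ) {e : ℝ} (he : |e| ≤ 1) :
    |(1 - p) / (2 * n ^ 2 * p) * ((n - 4) * ((n - 2) * (p * (1 - p)) * (s ^ 2 + t ^ 2) +
      (1 - 2 * p) * (s ^ 2 * (a - e) + t ^ 2 * (a' - e)) + 2 * s * t * C) +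
      (s * (a - e) + t * (a' - e)) ^ 2) - (1 - p) ^ 2 * (s ^ 2 + t ^ 2) / 2| ≤
      3 * (s ^ 2 + t ^ 2) / n + (s ^ 2 + t ^ 2) / (2 * n * p) * (|a| + |a'| + 1 + |C|) +
      2 * (s ^ 2 + t ^ 2) / (n ^ 2 * p) * (a ^ 2 + a' ^ 2 + 2) := by
  have hn0 : 0 < n := by linarith
  have hA : 0 ≤ s ^ 2 + t ^ 2 := by positivity
  have he2 : e ^ 2 ≤ 1 := by rw [← sq_abs]; exact pow_le_one₀ (abs_nonneg _) he
  set A := s ^ 2 + t ^ 2 with hAdef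
  set L := (1 - 2 * p) * (s ^ 2 * (a - e) + t ^ 2 * (a' - e)) + 2 * s * t * C with hL
  set Q := (s * (a - e) + t * (a' - e)) ^ 2 with hQ
  have hLb : |L| ≤ A * (|a| + |a'| + 1 + |C|) := by
    have h1 : |a - e| ≤ |a| + |a'| + 1 := by
      linarith [abs_sub a e, abs_nonneg a']
    have h2 : |a' - e| ≤ |a| + |a'| + 1 := by
      linarith [abs_sub a' e, abs_nonneg a]
    have h3 : |s ^ 2 * (a - e) + t ^ 2 * (a' - e)| ≤ A * (|a| + |a'| + 1) := by
      refine (abs_add_le _ _).trans ?_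
      rw [abs_mul, abs_mul, abs_of_nonneg (sq_nonneg s), abs_of_nonneg (sq_nonneg t), hAdef,
        add_mul]
      gcongr
    have h4 : |2 * s * t * C| ≤ A * |C| := by
      rw [abs_mul]
      gcongr
      rw [abs_le]
      constructor <;> nlinarith [sq_nonneg (s - t), sq_nonneg (s + t)]
    have h5 : |1 - 2 * p| ≤ 1 := by rw [abs_le]; constructor <;> linarith
    calc |L| ≤ |1 - 2 * p| * |s ^ 2 * (a - e) + t ^ 2 * (a' - e)| + |2 * s * t * C| := by
          rw [hL, ← abs_mul]; exact abs_add_le _ _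
      _ ≤ 1 * (A * (|a| + |a'| + 1)) + A * |C| := by gcongr
      _ = _ := by ring
  have hQ0 : 0 ≤ Q := sq_nonneg _
  have hQb : Q ≤ 2 * A * (a ^ 2 + a' ^ 2 + 2) := by
    have h1 : Q ≤ A * ((a - e) ^ 2 + (a' - e) ^ 2) := by
      rw [hQ, hAdef]
      nlinarith [sq_nonneg (s * (a' - e) - t * (a - e))]
    have h2 : (a - e) ^ 2 + (a' - e) ^ 2 ≤ 2 * (a ^ 2 + a' ^ 2 + 2) := by
      nlinarith [sq_nonneg (a + e), sq_nonneg (a' + e)]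
    nlinarith
  have key : (1 - p) / (2 * n ^ 2 * p) * ((n - 4) * ((n - 2) * (p * (1 - p)) * A +
      (1 - 2 * p) * (s ^ 2 * (a - e) + t ^ 2 * (a' - e)) + 2 * s * t * C) + Q) -
      (1 - p) ^ 2 * A / 2 =
      (1 - p) ^ 2 * (8 - 6 * n) * A / (2 * n ^ 2) + (1 - p) * (n - 4) * L / (2 * n ^ 2 * p) +
        (1 - p) * Q / (2 * n ^ 2 * p) := by
    rw [hL]
    field_simp
    ring
  rw [key]
  have hp2 : (1 - p) ^ 2 ≤ 1 := pow_le_one₀ (by linarith) (by linarith)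
  have t1 : |(1 - p) ^ 2 * (8 - 6 * n) * A / (2 * n ^ 2)| ≤ 3 * A / n := by
    rw [abs_div, abs_mul, abs_mul, abs_of_nonneg (sq_nonneg (1 - p)), abs_of_nonneg hA,
      abs_of_pos (by positivity : 0 < 2 * n ^ 2), div_le_div_iff₀ (by positivity) hn0]
    have h1 : |8 - 6 * n| ≤ 6 * n := by rw [abs_le]; constructor <;> linarith
    calc (1 - p) ^ 2 * |8 - 6 * n| * A * n ≤ 1 * (6 * n) * A * n := by gcongr
      _ = 3 * A * (2 * n ^ 2) := by ring
  have t2 : |(1 - p) * (n - 4) * L / (2 * n ^ 2 * p)| ≤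
      A / (2 * n * p) * (|a| + |a'| + 1 + |C|) := by
    rw [abs_div, abs_mul, abs_mul, abs_of_nonneg (by linarith : 0 ≤ 1 - p),
      abs_of_pos (by positivity : 0 < 2 * n ^ 2 * p), div_mul_eq_mul_div,
      div_le_div_iff₀ (by positivity) (by positivity)]
    have h1 : |n - 4| ≤ n := by rw [abs_le]; constructor <;> linarith
    calc (1 - p) * |n - 4| * |L| * (2 * n * p)
        ≤ 1 * n * (A * (|a| + |a'| + 1 + |C|)) * (2 * n * p) := by gcongr; linarith
      _ = A * (|a| + |a'| + 1 + |C|) * (2 * n ^ 2 * p) := by ring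
  have t3 : |(1 - p) * Q / (2 * n ^ 2 * p)| ≤ 2 * A / (n ^ 2 * p) * (a ^ 2 + a' ^ 2 + 2) := by
    rw [abs_of_nonneg (div_nonneg (mul_nonneg (by linarith) hQ0) (by positivity)),
      div_mul_eq_mul_div, div_le_div_iff₀ (by positivity) (by positivity)]
    calc (1 - p) * Q * (n ^ 2 * p) ≤ 1 * (2 * A * (a ^ 2 + a' ^ 2 + 2)) * (n ^ 2 * p) := by
          gcongr; linarith
      _ ≤ 2 * A * (a ^ 2 + a' ^ 2 + 2) * (2 * n ^ 2 * p) := by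
          have : 0 ≤ 2 * A * (a ^ 2 + a' ^ 2 + 2) * (n ^ 2 * p) := by positivity
          linarith
  have := abs_add_three ((1 - p) ^ 2 * (8 - 6 * n) * A / (2 * n ^ 2))
    ((1 - p) * (n - 4) * L / (2 * n ^ 2 * p)) ((1 - p) * Q / (2 * n ^ 2 * p))
  linarith

/-- Quantitative joint central limit theorem for the main sums of two distinct vertices, uniform in
the two vertices. -/
theorem norm_integral_exp_mainSum_sub_le [LinearOrder V] (hp0 : (0 : ℝ) < p) {v u : V} (h : v ≠ u)
    (s t : ℝ) :
    ‖∫ G, Complex.exp ((((s * mainSum p G v u + t * mainSum p G u v) /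
          (Fintype.card V * p) : ℝ) : ℂ) * Complex.I) ∂(binomialRandom V p) -
        ((Real.exp (-((1 - p) ^ 2 * (s ^ 2 + t ^ 2) / 2)) : ℝ) : ℂ)‖ ≤
      (32 * (|s| + |t|) ^ 3 / p ^ 3 + 13 * (s ^ 2 + t ^ 2) / p) / √(Fintype.card V) := by
  set n : ℝ := (Fintype.card V : ℝ) with hn
  have hn2 : 2 ≤ n := by
    rw [hn]
    exact_mod_cast Fintype.one_lt_card_iff.2 ⟨v, u, h⟩
  have hn0 : 0 < n := by linarith
  have hq0 : (0 : ℝ) ≤ 1 - p := by linarith [p.2.2]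
  have hp1 : (p : ℝ) ≤ 1 := p.2.2
  set r := √n with hr
  have hr0 : 0 < r := Real.sqrt_pos.2 hn0
  have hrr : r * r = n := Real.mul_self_sqrt hn0.le
  have hr1 : 1 ≤ r := Real.one_le_sqrt.2 (by linarith)
  set W : Finset V := {v, u}ᶜ with hW
  have hWn : (W.card : ℝ) = n - 2 := by
    rw [hW, Finset.card_compl, Finset.card_pair h, Nat.cast_sub, hn]
    · simp
    · exact Fintype.one_lt_card_iff.2 ⟨v, u, h⟩
  set T := (W ×ˢ W).filter (fun e => e.1 < e.2) with hTdef
  have hTcard : (T.card : ℝ) ≤ n ^ 2 := by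
    have h1 : T.card ≤ Fintype.card V ^ 2 := by
      refine (Finset.card_filter_le _ _).trans ?_
      rw [Finset.card_product, ← sq]
      exact Nat.pow_le_pow_left (Finset.card_le_univ _) 2
    rw [hn]; exact_mod_cast h1
  -- `s * mainSum p G v u + t * mainSum p G u v` is `∑ x ∈ W, ∑ y ∈ W, b G x * centered p G x y`,
  -- so `c G e` is the coefficient of the edge `e` after division by `n * p`.
  let b : SimpleGraph V → V → ℝ := fun G x => s * centered p G v x + t * centered p G u x
  let c : SimpleGraph V → V × V → ℝ := fun G e => (b G e.1 + b G e.2) / (n * p)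
  have hb : ∀ G x, |b G x| ≤ |s| + |t| := by
    intro G x
    refine (abs_add_le _ _).trans ?_
    rw [abs_mul, abs_mul]
    have h1 := abs_centered_le p G hp0.le hp1 v x
    have h2 := abs_centered_le p G hp0.le hp1 u x
    exact add_le_add (mul_le_of_le_one_right (abs_nonneg _) h1)
      (mul_le_of_le_one_right (abs_nonneg _) h2)
  have hcB : ∀ G, ∀ e ∈ T, |c G e| ≤ 2 * (|s| + |t|) / (n * p) := by
    intro G e _
    simp only [c]
    rw [abs_div, abs_of_pos (mul_pos hn0 hp0)]
    gcongr
    linarith [abs_add_le (b G e.1) (b G e.2), hb G e.1, hb G e.2]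
  have hc : ∀ e ∈ T, ∀ G, c (G ∆ edge e.1 e.2) = c G := by
    intro e he G
    have he' : e.1 ≠ v ∧ e.1 ≠ u ∧ e.2 ≠ v ∧ e.2 ≠ u := by
      simp [hTdef, hW] at he
      tauto
    have h1 : ∀ w x, (w = v ∨ w = u) → centered p (G ∆ edge e.1 e.2) w x = centered p G w x := by
      intro w x hw
      refine centered_toggle _ _ ?_
      rw [Ne, Sym2.eq_iff]
      rintro (h | h) <;> rcases hw with rfl | rfl <;> tauto
    funext f
    simp only [c, b]
    rw [h1 v _ (.inl rfl), h1 v _ (.inl rfl), h1 u _ (.inr rfl), h1 u _ (.inr rfl)]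
  have h1 := norm_integral_exp_sub_le (p := p) T (fun e he => (Finset.mem_filter.1 he).2) c hc hcB
  have hΘ : ∀ G, ∑ e ∈ T, c G e * centered p G e.1 e.2 =
      (s * mainSum p G v u + t * mainSum p G u v) / (n * p) := by
    intro G
    have h2 := sum_sum_eq_sum_lt W fun x y => b G x * centered p G x y
    have h3 : mainSum p G u v =
        ∑ x ∈ W, ∑ y ∈ W, centered p G u x * centered p G x y := by
      rw [mainSum, Finset.pair_comm]
    have h4 : mainSum p G v u =
        ∑ x ∈ W, ∑ y ∈ W, centered p G v x * centered p G x y := rfl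
    have h5 : s * mainSum p G v u + t * mainSum p G u v =
        ∑ x ∈ W, ∑ y ∈ W, b G x * centered p G x y := by
      rw [h3, h4]
      simp_rw [Finset.mul_sum, ← Finset.sum_add_distrib]
      refine Finset.sum_congr rfl fun x _ => Finset.sum_congr rfl fun y _ => ?_
      simp only [b]; ring
    rw [h5, h2]
    simp only [centered_self, mul_zero, Finset.sum_const_zero, add_zero]
    rw [Finset.sum_div]
    refine Finset.sum_congr rfl fun e _ => ?_
    rw [centered_comm p G e.2 e.1]
    simp only [c]
    ring
  have hquad : ∀ G, (p : ℝ) * (1 - p) / 2 * ∑ e ∈ T, c G e ^ 2 =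
      (1 - p) / (2 * n ^ 2 * p) * ((n - 4) * ∑ x ∈ W, b G x ^ 2 + (∑ x ∈ W, b G x) ^ 2) := by
    intro G
    have h2 := sum_lt_add_sq W (b G)
    have h3 : ∑ e ∈ T, c G e ^ 2 =
        (∑ e ∈ T, (b G e.1 + b G e.2) ^ 2) / (n * p) ^ 2 := by
      rw [Finset.sum_div]
      exact Finset.sum_congr rfl fun e _ => div_pow _ _ _
    rw [h3, h2, hWn]
    field_simp
    ring
  have hB1 : ∀ G, ∑ x ∈ W, b G x = s * (rowSum p G v - centered p G v u) +
      t * (rowSum p G u - centered p G v u) := by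
    intro G
    simp only [b, Finset.sum_add_distrib, ← Finset.mul_sum]
    rw [sum_compl_pair h, sum_compl_pair h, centered_self, centered_self, centered_comm p G u v,
      rowSum, rowSum]
    ring
  have hB2 : ∀ G, ∑ x ∈ W, b G x ^ 2 = (n - 2) * (p * (1 - p)) * (s ^ 2 + t ^ 2) +
      (1 - 2 * p) * (s ^ 2 * (rowSum p G v - centered p G v u) +
        t ^ 2 * (rowSum p G u - centered p G v u)) + 2 * s * t * codegreeSum p G v u := by
    intro G
    have hb2 : ∀ x, b G x ^ 2 = s ^ 2 * centered p G v x ^ 2 + t ^ 2 * centered p G u x ^ 2 +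
        2 * s * t * (centered p G v x * centered p G u x) := fun x => by simp only [b]; ring
    simp_rw [hb2, Finset.sum_add_distrib, ← Finset.mul_sum]
    rw [sum_compl_pair h, sum_compl_pair h, sum_compl_pair h, sum_centered_sq, sum_centered_sq,
      centered_self, centered_self, centered_comm p G u v, centered_sq p G h, codegreeSum, ← hn]
    ring
  set A := s ^ 2 + t ^ 2 with hA
  have hA0 : 0 ≤ A := by positivity
  have hpt : ∀ G, |(p : ℝ) * (1 - p) / 2 * ∑ e ∈ T, c G e ^ 2 - (1 - p) ^ 2 * A / 2| ≤
      3 * A / n + A / (2 * n * p) * (|rowSum p G v| + |rowSum p G u| + 1 + |codegreeSum p G v u|) +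
      2 * A / (n ^ 2 * p) * (rowSum p G v ^ 2 + rowSum p G u ^ 2 + 2) := by
    intro G
    rw [hquad, hB2, hB1]
    generalize rowSum (p : ℝ) G v = a
    generalize rowSum (p : ℝ) G u = a'
    generalize codegreeSum (p : ℝ) G v u = C
    have he := abs_centered_le p G hp0.le hp1 v u
    generalize centered (p : ℝ) G v u = e at he
    exact abs_quadratic_sub_le hn2 hp0 hp1 s t a a' C he
  have hRv := integral_abs_le_sqrt _ hn0 (integral_rowSum_sq_le (p := p) v)
  have hRu := integral_abs_le_sqrt _ hn0 (integral_rowSum_sq_le (p := p) u)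
  have hC := integral_abs_le_sqrt _ hn0 (integral_codegreeSum_sq_le (p := p) h)
  have hint : ∫ G, |(p : ℝ) * (1 - p) / 2 * ∑ e ∈ T, c G e ^ 2 - (1 - p) ^ 2 * A / 2|
      ∂(binomialRandom V p) ≤ 13 * A / p / r := by
    calc _ ≤ ∫ G, (3 * A / n + A / (2 * n * p) *
            (|rowSum p G v| + |rowSum p G u| + 1 + |codegreeSum p G v u|) +
            2 * A / (n ^ 2 * p) * (rowSum p G v ^ 2 + rowSum p G u ^ 2 + 2))
            ∂(binomialRandom V p) := integral_mono .of_finite .of_finite hpt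
      _ = 3 * A / n + A / (2 * n * p) * (∫ G, |rowSum p G v| ∂(binomialRandom V p) +
            ∫ G, |rowSum p G u| ∂(binomialRandom V p) + 1 +
            ∫ G, |codegreeSum p G v u| ∂(binomialRandom V p)) +
            2 * A / (n ^ 2 * p) * (∫ G, rowSum p G v ^ 2 ∂(binomialRandom V p) +
            ∫ G, rowSum p G u ^ 2 ∂(binomialRandom V p) + 2) := by
          rw [integral_add .of_finite .of_finite, integral_add .of_finite .of_finite,
            integral_const_mul, integral_const_mul, integral_add .of_finite .of_finite,
            integral_add .of_finite .of_finite, integral_add .of_finite .of_finite,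
            integral_add .of_finite .of_finite, integral_add .of_finite .of_finite]
          simp
      _ ≤ 3 * A / n + A / (2 * n * p) * (r + r + 1 + r) +
            2 * A / (n ^ 2 * p) * (n + n + 2) := by
          gcongr
          · exact integral_rowSum_sq_le v
          · exact integral_rowSum_sq_le u
      _ ≤ 3 * A / p / r + 2 * A / p / r + 6 * A / p / r := by
          have hpr : 0 < (p : ℝ) * r := mul_pos hp0 hr0
          have hpn : (p : ℝ) * r ≤ n := by nlinarith
          have hpn' : (p : ℝ) * r ≤ n * p := by nlinarith
          gcongr ?_ + ?_ + ?_
          · rw [div_div]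
            gcongr
          · rw [div_div, div_mul_eq_mul_div, div_le_div_iff₀ (by positivity) hpr, ← hrr]
            have : 0 ≤ A * (p * r) * r * (r - 1) := by
              have : 0 ≤ r - 1 := by linarith
              positivity
            nlinarith
          · calc 2 * A / (n ^ 2 * p) * (n + n + 2) ≤ 2 * A / (n ^ 2 * p) * (3 * n) := by
                  gcongr; linarith
              _ = 6 * A / (n * p) := by field_simp; ring
              _ ≤ 6 * A / (p * r) := by gcongr
              _ = 6 * A / p / r := by rw [div_div]
      _ = 11 * A / p / r := by ring
      _ ≤ 13 * A / p / r := by gcongr; norm_num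
  have hgauss : ‖∫ G, ((Real.exp (-((p : ℝ) * (1 - p) / 2 * ∑ e ∈ T, c G e ^ 2)) : ℝ) : ℂ)
      ∂(binomialRandom V p) - ((Real.exp (-((1 - p) ^ 2 * A / 2)) : ℝ) : ℂ)‖ ≤ 13 * A / p / r := by
    have h2 : ((Real.exp (-((1 - p) ^ 2 * A / 2)) : ℝ) : ℂ) =
        ∫ _, ((Real.exp (-((1 - p) ^ 2 * A / 2)) : ℝ) : ℂ) ∂(binomialRandom V p) := by simp
    rw [h2, ← integral_sub .of_finite .of_finite]
    refine (norm_integral_le_integral_norm _).trans ((integral_mono .of_finite .of_finite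
      fun G => ?_).trans hint)
    simp only
    rw [← Complex.ofReal_sub, Complex.norm_real]
    exact abs_exp_neg_sub_le (by positivity) (by positivity)
  simp_rw [hΘ] at h1
  have hcube : (T.card : ℝ) * (4 * (2 * (|s| + |t|) / (n * p)) ^ 3) ≤
      32 * (|s| + |t|) ^ 3 / p ^ 3 / r := by
    calc (T.card : ℝ) * (4 * (2 * (|s| + |t|) / (n * p)) ^ 3) ≤
          n ^ 2 * (4 * (2 * (|s| + |t|) / (n * p)) ^ 3) := by gcongr
      _ = 32 * (|s| + |t|) ^ 3 / p ^ 3 / n := by field_simp; ring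
      _ ≤ 32 * (|s| + |t|) ^ 3 / p ^ 3 / r := by
          gcongr
          nlinarith
  have h3 := norm_sub_le_norm_sub_add_norm_sub
    (∫ G, Complex.exp ((((s * mainSum p G v u + t * mainSum p G u v) /
          (n * p) : ℝ) : ℂ) * Complex.I) ∂(binomialRandom V p))
    (∫ G, ((Real.exp (-((p : ℝ) * (1 - p) / 2 * ∑ e ∈ T, c G e ^ 2)) : ℝ) : ℂ)
      ∂(binomialRandom V p)) ((Real.exp (-((1 - p) ^ 2 * A / 2)) : ℝ) : ℂ)
  rw [add_div]
  linarith

end mainSum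

/-! ### The groupie condition in terms of centred edge indicators -/

section score

variable {V : Type*} [Fintype V]

open Classical in
/-- The quantity `(r(v) - 2 e deg(v) / n) / (n p)`. At an isolated vertex this is `0`, so `1` is
subtracted there if the graph has an edge; then `v` is a groupie if and only if the score is
nonnegative. -/
noncomputable def groupieScore (p : ℝ) (G : SimpleGraph V) (v : V) : ℝ :=
  (neighborDegreeSum G v - 2 * (G.edgeFinset.card : ℝ) * G.degree v / Fintype.card V) /
      (Fintype.card V * p) -
    if G.degree v = 0 ∧ ¬ ∀ w, G.degree w = 0 then 1 else 0

open Classical in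
lemma isGroupie_iff_groupieScore_nonneg {p : ℝ} (hp : 0 < p) (G : SimpleGraph V) (v : V) :
    IsGroupie G v ↔ 0 ≤ groupieScore p G v := by
  have hn : (0 : ℝ) < Fintype.card V := by
    exact_mod_cast Fintype.card_pos_iff.2 ⟨v⟩
  unfold IsGroupie groupieScore
  by_cases hd : G.degree v = 0
  · have hr : neighborDegreeSum G v = 0 := by
      unfold neighborDegreeSum
      rw [(G.neighborFinset_eq_empty v).2 ((G.degree_eq_zero v).1 hd), Finset.sum_empty]
    by_cases h : ∀ w, G.degree w = 0
    · simp [h, hr]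
    · simp only [hd, hr, if_true, h]
      simp
  · have hd' : (0 : ℝ) < G.degree v := by exact_mod_cast Nat.pos_of_ne_zero hd
    simp only [hd, if_false, false_and, sub_zero]
    rw [div_le_div_iff₀ hn hd', le_div_iff₀ (by positivity), zero_mul, sub_nonneg, div_le_iff₀ hn]

omit [Fintype V] in
lemma centered_eq (p : ℝ) (G : SimpleGraph V) [DecidableEq V] [DecidableRel G.Adj] (x y : V) :
    centered p G x y = (if G.Adj x y then 1 else 0) - p + if x = y then p else 0 := by
  by_cases h : x = y
  · subst h; simp
  · by_cases hG : G.Adj x y <;> simp [centered, h, hG]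

lemma degree_eq_rowSum (p : ℝ) (G : SimpleGraph V) [DecidableRel G.Adj] (v : V) :
    (G.degree v : ℝ) = rowSum p G v + p * (Fintype.card V - 1) := by
  classical
  simp_rw [rowSum, centered_eq, Finset.sum_add_distrib, Finset.sum_sub_distrib]
  rw [← G.card_neighborFinset_eq_degree, neighborFinset_eq_filter]
  simp
  ring

/-- The leading terms `p (n - 1) deg(v)` of `r(v)` and `2 e deg(v) / n` cancel. -/
lemma neighborDegreeSum_sub_eq (p : ℝ) (G : SimpleGraph V) [DecidableEq V] [DecidableRel G.Adj]
    (v : V) :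
    neighborDegreeSum G v - 2 * (G.edgeFinset.card : ℝ) * G.degree v / Fintype.card V =
      ∑ x, centered p G v x * rowSum p G x - p * rowSum p G v +
        p * totalSum p G / Fintype.card V -
        totalSum p G * rowSum p G v / Fintype.card V := by
  have hn : (0 : ℝ) < Fintype.card V := by
    exact_mod_cast Fintype.card_pos_iff.2 ⟨v⟩
  have he : 2 * (G.edgeFinset.card : ℝ) =
      totalSum p G + Fintype.card V * (p * (Fintype.card V - 1)) := by
    have h := G.sum_degrees_eq_twice_card_edges
    have h' : ∑ w, (G.degree w : ℝ) = 2 * (G.edgeFinset.card : ℝ) := by exact_mod_cast h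
    rw [← h']
    simp_rw [degree_eq_rowSum p G, Finset.sum_add_distrib]
    simp [totalSum]
  have hr : (neighborDegreeSum G v : ℝ) =
      p * (Fintype.card V - 1) * G.degree v + ∑ x, centered p G v x * rowSum p G x +
        p * (totalSum p G - rowSum p G v) := by
    have h1 : (neighborDegreeSum G v : ℝ) =
        ∑ x, (if G.Adj v x then (1 : ℝ) else 0) * (rowSum p G x + p * (Fintype.card V - 1)) := by
      rw [neighborDegreeSum, neighborFinset_eq_filter, Finset.sum_filter]
      push_cast
      refine Finset.sum_congr rfl fun x _ => ?_
      rw [← degree_eq_rowSum]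
      split_ifs <;> simp
    have h2 : ∀ x, (if G.Adj v x then (1 : ℝ) else 0) = centered p G v x + p -
        if v = x then p else 0 := fun x => by rw [centered_eq]; ring
    rw [h1, degree_eq_rowSum p]
    simp_rw [h2, mul_add, sub_mul, add_mul, Finset.sum_add_distrib, Finset.sum_sub_distrib,
      Finset.sum_add_distrib, ← Finset.mul_sum, ← Finset.sum_mul]
    simp [totalSum, rowSum]
    ring
  rw [he, hr, degree_eq_rowSum p]
  field_simp
  ring

variable {p : unitInterval}

/-- Pointwise comparison of the score with its main part. The product of `totalSum` and `rowSum` is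
split by the weighted inequality of arithmetic and geometric means, so that only second moments are
needed afterwards. -/
lemma abs_groupieScore_sub_le [LinearOrder V] (hp0 : (0 : ℝ) < p) (G : SimpleGraph V) {v u : V}
    (h : v ≠ u) :
    |groupieScore p G v - (1 - p) - mainSum p G v u / (Fintype.card V * p)| ≤
      (4 * |rowSum p G v| + |rowSum p G u| + |codegreeSum p G v u| + 3 +
        totalSum p G ^ 2 / (Fintype.card V : ℝ) ^ 2 +
        (totalSum p G ^ 2 / (Fintype.card V * √(Fintype.card V)) +
          rowSum p G v ^ 2 / √(Fintype.card V)) / 2) / (Fintype.card V * p) := by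
  classical
  set n : ℝ := (Fintype.card V : ℝ) with hn
  have hn2 : 2 ≤ n := by
    rw [hn]
    exact_mod_cast Fintype.one_lt_card_iff.2 ⟨v, u, h⟩
  have hn0 : 0 < n := by linarith
  have hp1 : (p : ℝ) ≤ 1 := p.2.2
  set r := √n with hr
  have hr0 : 0 < r := Real.sqrt_pos.2 hn0
  have hrr : r * r = n := Real.mul_self_sqrt hn0.le
  have he := abs_centered_le p G hp0.le hp1 v u
  set δ : ℝ := if G.degree v = 0 ∧ ¬ ∀ w, G.degree w = 0 then 1 else 0 with hδ
  -- An isolated vertex has centred degree `-p * (n - 1)`, which is large.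
  have hδb : |n * p * δ| ≤ 2 * |rowSum p G v| := by
    rw [hδ]
    split_ifs with hd
    · have h1 := degree_eq_rowSum p G v
      rw [hd.1, Nat.cast_zero] at h1
      have h2 : rowSum p G v = -(p * (n - 1)) := by linarith
      rw [h2, abs_neg, abs_of_nonneg (by positivity),
        abs_of_nonneg (mul_nonneg hp0.le (by linarith))]
      nlinarith
    · simp
  have hS1 : |p * totalSum p G / n| ≤ totalSum p G ^ 2 / n ^ 2 + 1 := by
    have h1 : |p * totalSum p G / n| ≤ |totalSum p G / n| := by
      rw [mul_div_assoc, abs_mul, abs_of_pos hp0]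
      exact mul_le_of_le_one_left (abs_nonneg _) hp1
    rw [← div_pow, ← sq_abs (totalSum (p : ℝ) G / n)]
    nlinarith [sq_nonneg (|totalSum (p : ℝ) G / n| - 1), sq_nonneg (|totalSum (p : ℝ) G / n|)]
  have hS2 : |totalSum p G * rowSum p G v / n| ≤
      (totalSum p G ^ 2 / (n * r) + rowSum p G v ^ 2 / r) / 2 := by
    have h1 : (totalSum p G ^ 2 / (n * r) + rowSum p G v ^ 2 / r) / 2 =
        ((|totalSum p G| / r) ^ 2 + |rowSum p G v| ^ 2) / (2 * r) := by
      rw [div_pow, sq_abs, sq_abs, ← hrr]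
      field_simp
    have h2 : |totalSum p G * rowSum p G v / n| =
        (2 * (|totalSum p G| / r) * |rowSum p G v|) / (2 * r) := by
      rw [abs_div, abs_mul, abs_of_pos hn0, ← hrr]
      field_simp
    rw [h1, h2]
    gcongr
    exact two_mul_le_add_sq _ _
  have hA := neighborDegreeSum_sub_eq p G v
  rw [sum_centered_mul_rowSum p G h] at hA
  have hdef : groupieScore p G v - (1 - p) - mainSum p G v u / (n * p) =
      (centered p G v u * (rowSum p G u - centered p G v u) + codegreeSum p G v u +
        (1 - 3 * p) * rowSum p G v - p * (1 - p) + p * totalSum p G / n -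
        totalSum p G * rowSum p G v / n - n * p * δ) / (n * p) := by
    have h1 : groupieScore p G v = (neighborDegreeSum G v - 2 * (G.edgeFinset.card : ℝ) *
        G.degree v / n) / (n * p) - δ := by
      unfold groupieScore
      rw [hδ]
    rw [h1, hA, ← hn]
    field_simp
    ring
  rw [hdef, abs_div, abs_of_pos (mul_pos hn0 hp0)]
  gcongr
  have h1 : |centered p G v u * (rowSum p G u - centered p G v u)| ≤ |rowSum p G u| + 1 := by
    rw [abs_mul]
    have := abs_sub (rowSum p G u) (centered p G v u)
    calc _ ≤ 1 * |rowSum p G u - centered p G v u| := by gcongr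
      _ ≤ _ := by linarith
  have h2 : |(1 - 3 * p) * rowSum p G v| ≤ 2 * |rowSum p G v| := by
    rw [abs_mul]
    gcongr
    rw [abs_le]; constructor <;> linarith
  have h3 : |(p : ℝ) * (1 - p)| ≤ 1 := by
    rw [abs_le]; constructor <;> nlinarith
  generalize (p : ℝ) * (1 - p) = c3 at *
  rw [abs_le] at *
  constructor <;> linarith [neg_abs_le (codegreeSum p G v u), le_abs_self (codegreeSum p G v u)]

lemma integral_abs_groupieScore_sub_le [LinearOrder V] (hp0 : (0 : ℝ) < p) {v u : V} (h : v ≠ u) :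
    ∫ G, |groupieScore p G v - (1 - p) - mainSum p G v u / (Fintype.card V * p)|
      ∂(binomialRandom V p) ≤ 16 / p / √(Fintype.card V) := by
  set n : ℝ := (Fintype.card V : ℝ) with hn
  have hn2 : 2 ≤ n := by
    rw [hn]
    exact_mod_cast Fintype.one_lt_card_iff.2 ⟨v, u, h⟩
  have hn0 : 0 < n := by linarith
  set r := √n with hr
  have hr0 : 0 < r := Real.sqrt_pos.2 hn0
  have hrr : r * r = n := Real.mul_self_sqrt hn0.le
  have hr1 : 1 ≤ r := Real.one_le_sqrt.2 (by linarith)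
  have hRv := integral_abs_le_sqrt _ hn0 (integral_rowSum_sq_le (p := p) v)
  have hRu := integral_abs_le_sqrt _ hn0 (integral_rowSum_sq_le (p := p) u)
  have hC := integral_abs_le_sqrt _ hn0 (integral_codegreeSum_sq_le (p := p) h)
  have hS := integral_totalSum_sq_le (V := V) (p := p)
  have hR := integral_rowSum_sq_le (V := V) (p := p) v
  refine (integral_mono .of_finite .of_finite fun G => abs_groupieScore_sub_le hp0 G h).trans ?_
  rw [← hn, ← hr] at *
  simp only [integral_div]
  rw [integral_add .of_finite .of_finite, integral_add .of_finite .of_finite,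
    integral_add .of_finite .of_finite, integral_add .of_finite .of_finite,
    integral_add .of_finite .of_finite, integral_const_mul, integral_div, integral_div,
    integral_add .of_finite .of_finite, integral_div, integral_div]
  simp only [integral_const, probReal_univ, one_smul]
  have h1 : (∫ G, totalSum p G ^ 2 ∂(binomialRandom V p)) / n ^ 2 ≤ 4 := by
    rw [div_le_iff₀ (by positivity)]; exact hS
  have h2 : (∫ G, totalSum p G ^ 2 ∂(binomialRandom V p)) / (n * r) ≤ 4 * r := by
    rw [div_le_iff₀ (by positivity)]
    calc _ ≤ 4 * n ^ 2 := hS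
      _ = 4 * r * (n * r) := by rw [← hrr]; ring
  have h3 : (∫ G, rowSum p G v ^ 2 ∂(binomialRandom V p)) / r ≤ r := by
    rw [div_le_iff₀ hr0, hrr]; exact hR
  have h4 : 16 / p / r = 16 * r / (n * p) := by
    rw [← hrr]; field_simp
  rw [h4]
  gcongr
  linarith

end score

/-! ### The averaged law of pairs of scores and its limit -/

section limit

lemma norm_integral_exp_groupieScore_sub_le {V : Type*} [Fintype V] [LinearOrder V]
    {p : unitInterval} (hp0 : (0 : ℝ) < p) {v u : V} (h : v ≠ u) (s t : ℝ) :
    ‖∫ G, Complex.exp (((s * (groupieScore p G v - (1 - p)) +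
          t * (groupieScore p G u - (1 - p)) : ℝ) : ℂ) * Complex.I) ∂(binomialRandom V p) -
        ((Real.exp (-((1 - p) ^ 2 * (s ^ 2 + t ^ 2) / 2)) : ℝ) : ℂ)‖ ≤
      (32 * (|s| + |t|) ^ 3 / p ^ 3 + 13 * (s ^ 2 + t ^ 2) / p + 16 * (|s| + |t|) / p) /
        √(Fintype.card V) := by
  have h1 := norm_integral_exp_mainSum_sub_le (p := p) hp0 h s t
  have hv := integral_abs_groupieScore_sub_le (p := p) hp0 h
  have hu := integral_abs_groupieScore_sub_le (p := p) hp0 h.symm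
  set n : ℝ := (Fintype.card V : ℝ)
  have h2 : ‖∫ G, Complex.exp (((s * (groupieScore p G v - (1 - p)) +
        t * (groupieScore p G u - (1 - p)) : ℝ) : ℂ) * Complex.I) ∂(binomialRandom V p) -
      ∫ G, Complex.exp ((((s * mainSum p G v u + t * mainSum p G u v) /
        (n * p) : ℝ) : ℂ) * Complex.I) ∂(binomialRandom V p)‖ ≤
      |s| * (16 / p / √n) + |t| * (16 / p / √n) := by
    rw [← integral_sub .of_finite .of_finite]
    calc _ ≤ ∫ G, (|s| * |groupieScore p G v - (1 - p) - mainSum p G v u / (n * p)| +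
          |t| * |groupieScore p G u - (1 - p) - mainSum p G u v / (n * p)|)
          ∂(binomialRandom V p) := by
          refine (norm_integral_le_integral_norm _).trans
            (integral_mono .of_finite .of_finite fun G => ?_)
          refine (norm_exp_mul_I_sub_le _ _).trans ?_
          rw [← abs_mul, ← abs_mul]
          refine le_trans (le_of_eq ?_) (abs_add_le _ _)
          congr 1
          ring
      _ ≤ _ := by
          rw [integral_add .of_finite .of_finite, integral_const_mul, integral_const_mul]
          gcongr
  have h3 := norm_sub_le_norm_sub_add_norm_sub
    (∫ G, Complex.exp (((s * (groupieScore p G v - (1 - p)) +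
        t * (groupieScore p G u - (1 - p)) : ℝ) : ℂ) * Complex.I) ∂(binomialRandom V p))
    (∫ G, Complex.exp ((((s * mainSum p G v u + t * mainSum p G u v) /
        (n * p) : ℝ) : ℂ) * Complex.I) ∂(binomialRandom V p))
    ((Real.exp (-((1 - p) ^ 2 * (s ^ 2 + t ^ 2) / 2)) : ℝ) : ℂ)
  have h4 : |s| * (16 / p / √n) + |t| * (16 / p / √n) = 16 * (|s| + |t|) / p / √n := by ring
  rw [add_div _ (16 * (|s| + |t|) / (p : ℝ))]
  linarith

/-- The affine normalisation of `groupieScore` that is asymptotically standard normal; a vertex is a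
groupie if and only if it is at most `1`. -/
noncomputable def standardScore {V : Type*} [Fintype V] (p : ℝ) (G : SimpleGraph V) (v : V) : ℝ :=
  1 - groupieScore p G v / (1 - p)

open Classical in
lemma isGroupie_iff_standardScore_le {V : Type*} [Fintype V] {p : ℝ} (hp0 : 0 < p) (hp1 : p < 1)
    (G : SimpleGraph V) (v : V) : IsGroupie G v ↔ standardScore p G v ≤ 1 := by
  rw [isGroupie_iff_groupieScore_nonneg hp0, standardScore, sub_le_self_iff,
    le_div_iff₀ (by linarith), zero_mul]

lemma exists_norm_integral_exp_standardScore_sub_le {p : unitInterval} (hp0 : (0 : ℝ) < p)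
    (hp1 : (p : ℝ) < 1) (s t : ℝ) :
    ∃ C : ℝ, 0 ≤ C ∧ ∀ (n : ℕ) (v u : Fin n), v ≠ u →
      ‖∫ G, Complex.exp (((standardScore p G v * s + standardScore p G u * t : ℝ) : ℂ) *
          Complex.I) ∂(binomialRandom (Fin n) p) -
        ((Real.exp (-((s ^ 2 + t ^ 2) / 2)) : ℝ) : ℂ)‖ ≤ C / √n := by
  have hq : (0 : ℝ) < 1 - p := by linarith
  set s' : ℝ := -s / (1 - p) with hs'
  set t' : ℝ := -t / (1 - p) with ht'
  refine ⟨32 * (|s'| + |t'|) ^ 3 / p ^ 3 + 13 * (s' ^ 2 + t' ^ 2) / p + 16 * (|s'| + |t'|) / p,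
    by positivity, fun n v u h => ?_⟩
  have h1 := norm_integral_exp_groupieScore_sub_le hp0 h s' t'
  rw [Fintype.card_fin] at h1
  convert h1 using 8
  · simp only [hs', ht', standardScore]
    field_simp
    ring
  · simp only [hs', ht']
    field_simp

/-- The joint law of the standard scores of two vertices chosen independently and uniformly at
random (the zero measure if `n = 0`). `WithLp 2` provides the inner product that characteristic functions
require. -/
noncomputable def pairLaw (p : unitInterval) (n : ℕ) : Measure (WithLp 2 (ℝ × ℝ)) :=
  ∑ v : Fin n, ∑ u : Fin n, ((n : ℝ≥0∞) ^ 2)⁻¹ •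
    (binomialRandom (Fin n) p).map
      fun G => WithLp.toLp 2 (standardScore p G v, standardScore p G u)

instance isProbabilityMeasure_pairLaw (p : unitInterval) (n : ℕ) [NeZero n] :
    IsProbabilityMeasure (pairLaw p n) := by
  constructor
  have h : ∀ v u : Fin n, (binomialRandom (Fin n) p).map
      (fun G => WithLp.toLp 2 (standardScore p G v, standardScore p G u)) Set.univ = 1 := by
    intro v u
    rw [Measure.map_apply (measurable_of_finite _) MeasurableSet.univ]
    simp
  simp only [pairLaw, Measure.finsetSum_apply, Measure.smul_apply, h, smul_eq_mul, mul_one,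
    Finset.sum_const, Finset.card_univ, Fintype.card_fin, nsmul_eq_mul]
  rw [← mul_assoc, ← sq]
  exact ENNReal.mul_inv_cancel (by simp [NeZero.ne n]) (by finiteness)

lemma integral_pairLaw {E : Type*} [NormedAddCommGroup E] [NormedSpace ℝ E] (p : unitInterval)
    (n : ℕ) {f : WithLp 2 (ℝ × ℝ) → E} (hf : StronglyMeasurable f) :
    ∫ x, f x ∂(pairLaw p n) = ((n : ℝ) ^ 2)⁻¹ • ∑ v : Fin n, ∑ u : Fin n,
      ∫ G, f (WithLp.toLp 2 (standardScore p G v, standardScore p G u))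
        ∂(binomialRandom (Fin n) p) := by
  rcases Nat.eq_zero_or_pos n with rfl | hn
  · simp [pairLaw]
  have hi : ∀ v u : Fin n, Integrable f (((n : ℝ≥0∞) ^ 2)⁻¹ • (binomialRandom (Fin n) p).map
      fun G => WithLp.toLp 2 (standardScore p G v, standardScore p G u)) := by
    intro v u
    refine Integrable.smul_measure ?_ (by simp [hn.ne'])
    rw [integrable_map_measure hf.aestronglyMeasurable (measurable_of_finite _).aemeasurable]
    exact .of_finite
  rw [pairLaw,
    integral_finsetSum_measure fun v _ => integrable_finsetSum_measure.2 fun u _ => hi v u,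
    Finset.smul_sum]
  refine Finset.sum_congr rfl fun v _ => ?_
  rw [integral_finsetSum_measure fun u _ => hi v u, Finset.smul_sum]
  refine Finset.sum_congr rfl fun u _ => ?_
  rw [integral_smul_measure, integral_map (measurable_of_finite _).aemeasurable
    hf.aestronglyMeasurable]
  simp

/-- The law of two independent standard normal variables. -/
noncomputable def gaussianPair : Measure (WithLp 2 (ℝ × ℝ)) :=
  ((gaussianReal 0 1).prod (gaussianReal 0 1)).map (WithLp.toLp 2)

instance : IsProbabilityMeasure gaussianPair :=
  Measure.isProbabilityMeasure_map (by fun_prop)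

/-- The `n` diagonal pairs, out of `n ^ 2`, are bounded trivially. -/
lemma norm_charFun_pairLaw_sub_le {p : unitInterval} (hp0 : (0 : ℝ) < p)
    (hp1 : (p : ℝ) < 1) (z : WithLp 2 (ℝ × ℝ)) :
    ∃ C : ℝ, ∀ n : ℕ, 0 < n → ‖charFun (pairLaw p n) z - charFun gaussianPair z‖ ≤ C / √n := by
  obtain ⟨C, hC0, hC⟩ := exists_norm_integral_exp_standardScore_sub_le hp0 hp1 z.fst z.snd
  refine ⟨C + 2, fun n hn => ?_⟩
  have hn' : (0 : ℝ) < n := by exact_mod_cast hn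
  have hn1 : (1 : ℝ) ≤ n := by exact_mod_cast hn
  set c : ℂ := ((Real.exp (-((z.fst ^ 2 + z.snd ^ 2) / 2)) : ℝ) : ℂ) with hc
  have hc1 : ‖c‖ ≤ 1 := by
    rw [hc, Complex.norm_real, Real.norm_of_nonneg (Real.exp_nonneg _), Real.exp_le_one_iff]
    have : 0 ≤ (z.fst ^ 2 + z.snd ^ 2) / 2 := by positivity
    linarith
  have hg : charFun gaussianPair z = c := by
    rw [gaussianPair, charFun_prod, charFun_gaussianReal, charFun_gaussianReal, ← Complex.exp_add,
      hc, Complex.ofReal_exp]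
    congr 1
    simp
    ring
  have hI : charFun (pairLaw p n) z = ((n : ℝ) ^ 2)⁻¹ • ∑ v : Fin n, ∑ u : Fin n,
      ∫ G, Complex.exp (((standardScore p G v * z.fst + standardScore p G u * z.snd : ℝ) : ℂ) *
          Complex.I) ∂(binomialRandom (Fin n) p) := by
    rw [charFun_apply, integral_pairLaw p n]
    · simp [WithLp.prod_inner_apply, mul_comm]
    · exact (by fun_prop : Continuous _).stronglyMeasurable
  have hdiff : charFun (pairLaw p n) z - c = ((n : ℝ) ^ 2)⁻¹ • ∑ v : Fin n, ∑ u : Fin n,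
      (∫ G, Complex.exp (((standardScore p G v * z.fst + standardScore p G u * z.snd : ℝ) : ℂ) *
          Complex.I) ∂(binomialRandom (Fin n) p) - c) := by
    rw [hI]
    simp_rw [Finset.sum_sub_distrib]
    rw [smul_sub]
    congr 1
    have hnC : (n : ℂ) ≠ 0 := by exact_mod_cast hn.ne'
    simp [Complex.real_smul]
    field_simp
  have hterm : ∀ v u : Fin n, ‖∫ G, Complex.exp (((standardScore p G v * z.fst +
      standardScore p G u * z.snd : ℝ) : ℂ) * Complex.I) ∂(binomialRandom (Fin n) p) - c‖ ≤
      C / √n + if v = u then 2 else 0 := by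
    intro v u
    by_cases h : v = u
    · rw [if_pos h]
      refine (norm_sub_le _ _).trans ?_
      have h1 : ‖∫ G, Complex.exp (((standardScore p G v * z.fst +
          standardScore p G u * z.snd : ℝ) : ℂ) * Complex.I) ∂(binomialRandom (Fin n) p)‖ ≤ 1 := by
        refine (norm_integral_le_of_norm_le_const (C := 1) (.of_forall fun G => ?_)).trans (by simp)
        rw [Complex.norm_exp_ofReal_mul_I]
      have : 0 ≤ C / √n := by positivity
      linarith
    · simpa [h] using hC n v u h
  rw [hg, hdiff, norm_smul, Real.norm_of_nonneg (by positivity)]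
  calc ((n : ℝ) ^ 2)⁻¹ * ‖_‖ ≤ ((n : ℝ) ^ 2)⁻¹ *
        ∑ v : Fin n, ∑ u : Fin n, (C / √n + if v = u then 2 else 0) := by
        gcongr
        exact (norm_sum_le _ _).trans (Finset.sum_le_sum fun v _ =>
          (norm_sum_le _ _).trans (Finset.sum_le_sum fun u _ => hterm v u))
    _ = C / √n + 2 / n := by
        simp [Finset.sum_add_distrib]
        field_simp
    _ ≤ C / √n + 2 / √n := by
        gcongr
        exact (Real.sqrt_le_left hn'.le).2 (by nlinarith)
    _ = (C + 2) / √n := by ring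

lemma tendsto_pairLaw {p : unitInterval} (hp0 : (0 : ℝ) < p) (hp1 : (p : ℝ) < 1) :
    Tendsto (β := ProbabilityMeasure (WithLp 2 (ℝ × ℝ)))
      (fun n : ℕ => ⟨pairLaw p (n + 1), inferInstance⟩) atTop
      (𝓝 ⟨gaussianPair, inferInstance⟩) := by
  refine ProbabilityMeasure.tendsto_of_tendsto_charFun fun z => ?_
  obtain ⟨C, hC⟩ := norm_charFun_pairLaw_sub_le hp0 hp1 z
  rw [tendsto_iff_norm_sub_tendsto_zero]
  refine squeeze_zero (fun _ => norm_nonneg _) (fun n => hC (n + 1) n.succ_pos) ?_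
  refine Tendsto.const_div_atTop ?_ C
  exact Real.tendsto_sqrt_atTop.comp (tendsto_natCast_atTop_atTop.comp (tendsto_add_atTop_nat 1))

lemma tendsto_pairLaw_real {p : unitInterval} (hp0 : (0 : ℝ) < p) (hp1 : (p : ℝ) < 1)
    {S : Set (WithLp 2 (ℝ × ℝ))} (hS : gaussianPair (frontier S) = 0) :
    Tendsto (fun n : ℕ => (pairLaw p (n + 1)).real S) atTop (𝓝 (gaussianPair.real S)) :=
  (ENNReal.tendsto_toReal (measure_ne_top _ _)).comp
    (ProbabilityMeasure.tendsto_measure_of_null_frontier_of_tendsto' (tendsto_pairLaw hp0 hp1) hS)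

lemma measurable_withLp_fst : Measurable fun x : WithLp 2 (ℝ × ℝ) => x.fst :=
  (by fun_prop : Continuous _).measurable

lemma measurable_withLp_snd : Measurable fun x : WithLp 2 (ℝ × ℝ) => x.snd :=
  (by fun_prop : Continuous _).measurable

lemma gaussianPair_preimage {A B : Set ℝ} (hA : MeasurableSet A) (hB : MeasurableSet B) :
    gaussianPair ((fun x => x.fst) ⁻¹' A ∩ (fun x => x.snd) ⁻¹' B) =
      gaussianReal 0 1 A * gaussianReal 0 1 B := by
  rw [gaussianPair, Measure.map_apply (by fun_prop)
    ((measurable_withLp_fst hA).inter (measurable_withLp_snd hB)), ← Measure.prod_prod]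
  rfl

lemma gaussianReal_frontier_Iic (a : ℝ) : gaussianReal 0 1 (frontier (Set.Iic a)) = 0 := by
  have := nullSingletonClass_gaussianReal (μ := 0) (v := 1) one_ne_zero
  rw [frontier_Iic]
  exact measure_singleton a

lemma gaussianPair_frontier_fst (a : ℝ) :
    gaussianPair (frontier ((fun x => x.fst) ⁻¹' Set.Iic a)) = 0 := by
  refine measure_mono_null ((by fun_prop : Continuous fun x : WithLp 2 (ℝ × ℝ) =>
    x.fst).frontier_preimage_subset _) ?_
  have h := gaussianPair_preimage (isClosed_frontier (s := Set.Iic a)).measurableSet .univ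
  rwa [Set.preimage_univ, Set.inter_univ, gaussianReal_frontier_Iic, zero_mul] at h

lemma gaussianPair_frontier_snd (a : ℝ) :
    gaussianPair (frontier ((fun x => x.snd) ⁻¹' Set.Iic a)) = 0 := by
  refine measure_mono_null ((by fun_prop : Continuous fun x : WithLp 2 (ℝ × ℝ) =>
    x.snd).frontier_preimage_subset _) ?_
  have h := gaussianPair_preimage .univ (isClosed_frontier (s := Set.Iic a)).measurableSet
  rwa [Set.preimage_univ, Set.univ_inter, gaussianReal_frontier_Iic, mul_zero] at h

lemma gaussianPair_frontier_quadrant (a : ℝ) :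
    gaussianPair (frontier ((fun x => x.fst) ⁻¹' Set.Iic a ∩ (fun x => x.snd) ⁻¹' Set.Iic a)) =
      0 := by
  refine measure_mono_null (frontier_inter_subset _ _) (measure_union_null ?_ ?_)
  · exact measure_mono_null Set.inter_subset_left (gaussianPair_frontier_fst a)
  · exact measure_mono_null Set.inter_subset_right (gaussianPair_frontier_snd a)

lemma gaussianPair_real_fst (a : ℝ) :
    gaussianPair.real ((fun x => x.fst) ⁻¹' Set.Iic a) = stdNormalCDF a := by
  have h := gaussianPair_preimage (measurableSet_Iic (a := a)) .univ
  rw [Set.preimage_univ, Set.inter_univ, measure_univ, mul_one] at h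
  rw [stdNormalCDF, cdf_eq_real, measureReal_def, h, measureReal_def]

lemma gaussianPair_real_quadrant (a : ℝ) :
    gaussianPair.real ((fun x => x.fst) ⁻¹' Set.Iic a ∩ (fun x => x.snd) ⁻¹' Set.Iic a) =
      stdNormalCDF a ^ 2 := by
  rw [stdNormalCDF, cdf_eq_real, measureReal_def,
    gaussianPair_preimage measurableSet_Iic measurableSet_Iic, ENNReal.toReal_mul, sq,
    measureReal_def]

lemma groupieCount_eq_sum {V : Type*} [Fintype V] {p : ℝ} (hp0 : 0 < p) (hp1 : p < 1)
    (G : SimpleGraph V) :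
    (groupieCount G : ℝ) = ∑ v, (Set.Iic (1 : ℝ)).indicator 1 (standardScore p G v) := by
  classical
  simp only [groupieCount, isGroupie_iff_standardScore_le hp0 hp1]
  rw [Finset.card_filter]
  push_cast
  rfl

/-- The mass of a half-plane is the mean of the proportion of groupies. -/
lemma pairLaw_real_fst {p : unitInterval} (hp0 : (0 : ℝ) < p) (hp1 : (p : ℝ) < 1) (n : ℕ)
    (hn : n ≠ 0) :
    (pairLaw p n).real ((fun x => x.fst) ⁻¹' Set.Iic 1) =
      ∫ G, (groupieCount G : ℝ) / n ∂(binomialRandom (Fin n) p) := by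
  have hm := measurable_withLp_fst (measurableSet_Iic (a := (1 : ℝ)))
  have hn' : (n : ℝ) ≠ 0 := by exact_mod_cast hn
  rw [← integral_indicator_one hm, integral_pairLaw p n
    (stronglyMeasurable_one.indicator hm)]
  have h : ∀ v u : Fin n, ∀ G : SimpleGraph (Fin n),
      ((fun x : WithLp 2 (ℝ × ℝ) => x.fst) ⁻¹' Set.Iic 1).indicator (1 : WithLp 2 (ℝ × ℝ) → ℝ)
      (WithLp.toLp 2 (standardScore p G v, standardScore p G u)) =
      (Set.Iic (1 : ℝ)).indicator 1 (standardScore p G v) := fun v u G => rfl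
  simp_rw [h, groupieCount_eq_sum hp0 hp1]
  rw [integral_div, integral_finsetSum _ fun _ _ => .of_finite]
  simp [← Finset.mul_sum]
  field_simp

/-- The mass of a quadrant is the second moment of the proportion of groupies. -/
lemma pairLaw_real_quadrant {p : unitInterval} (hp0 : (0 : ℝ) < p) (hp1 : (p : ℝ) < 1) (n : ℕ) :
    (pairLaw p n).real ((fun x => x.fst) ⁻¹' Set.Iic 1 ∩ (fun x => x.snd) ⁻¹' Set.Iic 1) =
      ∫ G, ((groupieCount G : ℝ) / n) ^ 2 ∂(binomialRandom (Fin n) p) := by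
  have hm := (measurable_withLp_fst (measurableSet_Iic (a := (1 : ℝ)))).inter
    (measurable_withLp_snd (measurableSet_Iic (a := (1 : ℝ))))
  rw [← integral_indicator_one hm, integral_pairLaw p n
    (stronglyMeasurable_one.indicator hm)]
  have h : ∀ v u : Fin n, ∀ G : SimpleGraph (Fin n),
      ((fun x : WithLp 2 (ℝ × ℝ) => x.fst) ⁻¹' Set.Iic 1 ∩
        (fun x : WithLp 2 (ℝ × ℝ) => x.snd) ⁻¹' Set.Iic 1).indicator (1 : WithLp 2 (ℝ × ℝ) → ℝ)
      (WithLp.toLp 2 (standardScore p G v, standardScore p G u)) =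
      (Set.Iic (1 : ℝ)).indicator 1 (standardScore p G v) *
        (Set.Iic (1 : ℝ)).indicator 1 (standardScore p G u) := fun v u G => by
    rw [Set.inter_indicator_one]; rfl
  simp_rw [h, groupieCount_eq_sum hp0 hp1, div_pow]
  rw [integral_div]
  simp_rw [sq (∑ v, _), Finset.sum_mul_sum]
  rw [integral_finsetSum _ fun _ _ => .of_finite]
  simp_rw [integral_finsetSum Finset.univ fun _ _ => Integrable.of_finite]
  rw [smul_eq_mul, inv_mul_eq_div]

lemma tendsto_integral_sq_groupieCount_sub {p : unitInterval} (hp0 : (0 : ℝ) < p)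
    (hp1 : (p : ℝ) < 1) :
    Tendsto (fun n : ℕ => ∫ G, ((groupieCount G : ℝ) / n - stdNormalCDF 1) ^ 2
      ∂(binomialRandom (Fin n) p)) atTop (𝓝 0) := by
  rw [← tendsto_add_atTop_iff_nat 1]
  have h1 := tendsto_pairLaw_real hp0 hp1 (gaussianPair_frontier_fst 1)
  have h2 := tendsto_pairLaw_real hp0 hp1 (gaussianPair_frontier_quadrant 1)
  rw [gaussianPair_real_fst] at h1
  rw [gaussianPair_real_quadrant] at h2
  have h3 := (h2.sub (h1.const_mul (2 * stdNormalCDF 1))).add_const (stdNormalCDF 1 ^ 2)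
  have h0 : stdNormalCDF 1 ^ 2 - 2 * stdNormalCDF 1 * stdNormalCDF 1 + stdNormalCDF 1 ^ 2 = 0 := by
    ring
  rw [h0] at h3
  refine h3.congr fun n => ?_
  rw [pairLaw_real_fst hp0 hp1 _ n.succ_ne_zero, pairLaw_real_quadrant hp0 hp1,
    ← integral_const_mul, ← integral_sub .of_finite .of_finite]
  have hc : stdNormalCDF 1 ^ 2 = ∫ _, stdNormalCDF 1 ^ 2 ∂(binomialRandom (Fin (n + 1)) p) := by
    simp
  rw [hc, ← integral_add .of_finite .of_finite]
  refine integral_congr_ae (.of_forall fun G => ?_)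
  ring

theorem tendsto_binomialRandom_groupieCount {p : unitInterval} (hp0 : (0 : ℝ) < p)
    (hp1 : (p : ℝ) < 1) {ε : ℝ} (hε : 0 < ε) :
    Tendsto (fun n : ℕ => binomialRandom (Fin n) p
      {G | ε < |(groupieCount G : ℝ) / n - stdNormalCDF 1|}) atTop (𝓝 0) := by
  rw [← ENNReal.tendsto_toReal_zero_iff (fun _ => measure_ne_top _ _)]
  have h := (tendsto_integral_sq_groupieCount_sub hp0 hp1).div_const (ε ^ 2)
  rw [zero_div] at h
  refine squeeze_zero (fun _ => ENNReal.toReal_nonneg) (fun n => ?_) h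
  rw [le_div_iff₀ (by positivity), mul_comm]
  refine le_trans ?_ (mul_meas_ge_le_integral_of_nonneg (.of_forall fun G => sq_nonneg _)
    .of_finite (ε ^ 2))
  gcongr
  refine measureReal_mono fun G hG => ?_
  rw [Set.mem_ofPred_eq] at hG ⊢
  rw [← sq_abs (_ - _)]
  gcongr

end limit

/-! ### The numerical value of `Φ(1)` -/

section numerics

lemma gaussianReal_real_Iic_zero : (gaussianReal 0 1).real (Set.Iic 0) = 1 / 2 := by
  have := nullSingletonClass_gaussianReal (μ := 0) (v := 1) one_ne_zero
  have h1 : (gaussianReal 0 1).real (Set.Iic 0) = (gaussianReal 0 1).real (Set.Ici 0) := by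
    have h := gaussianReal_map_neg (μ := 0) (v := 1)
    rw [neg_zero] at h
    conv_lhs => rw [← h]
    rw [map_measureReal_apply measurable_neg measurableSet_Iic]
    congr 1
    ext x
    simp
  have h2 : (gaussianReal 0 1).real (Set.Ici 0) = (gaussianReal 0 1).real (Set.Iic 0)ᶜ := by
    rw [Set.compl_Iic]
    exact measureReal_congr Ioi_ae_eq_Ici.symm
  rw [probReal_compl_eq_one_sub measurableSet_Iic] at h2
  linarith

/-- Integration of the Taylor polynomial of degree `5` of `exp` at `-x ^ 2 / 2`; the remainder
contributes less than `2 * 10⁻⁶`. -/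
lemma integral_exp_neg_sq_div_two_bounds :
    0.85562 ≤ ∫ x in (0 : ℝ)..1, Real.exp (-x ^ 2 / 2) ∧
      ∫ x in (0 : ℝ)..1, Real.exp (-x ^ 2 / 2) ≤ 0.855625 := by
  have hb : ∀ x ∈ Set.Icc (0 : ℝ) 1, |Real.exp (-x ^ 2 / 2) -
      (1 - x ^ 2 / 2 + x ^ 4 / 8 - x ^ 6 / 48 + x ^ 8 / 384 - x ^ 10 / 3840)| ≤
      x ^ 12 * (7 / 276480) := by
    intro x hx
    have hx2 : x ^ 2 ≤ 1 := pow_le_one₀ hx.1 hx.2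
    have habs : |-x ^ 2 / 2| = x ^ 2 / 2 := by
      rw [neg_div, abs_neg, abs_of_nonneg (by positivity)]
    have h := Real.exp_bound (x := -x ^ 2 / 2) (by rw [habs]; linarith) (n := 6) (by norm_num)
    rw [habs] at h
    convert h using 1
    · congr 2
      simp [Finset.sum_range_succ, Nat.factorial]
      ring
    · simp [Nat.factorial]
      ring
  have hint : IntervalIntegrable (fun x : ℝ => Real.exp (-x ^ 2 / 2)) volume 0 1 :=
    (by fun_prop : Continuous _).intervalIntegrable _ _
  constructor
  · calc (0.85562 : ℝ) ≤ ∫ x in (0 : ℝ)..1, (1 - x ^ 2 / 2 + x ^ 4 / 8 - x ^ 6 / 48 + x ^ 8 / 384 -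
          x ^ 10 / 3840 - x ^ 12 * (7 / 276480)) := by
          simp (disch := exact (by fun_prop : Continuous _).intervalIntegrable _ _) only
            [intervalIntegral.integral_sub, intervalIntegral.integral_add,
            intervalIntegral.integral_div, intervalIntegral.integral_mul_const, integral_pow,
            intervalIntegral.integral_const]
          norm_num
      _ ≤ _ := by
          refine intervalIntegral.integral_mono_on zero_le_one
            ((by fun_prop : Continuous _).intervalIntegrable _ _) hint fun x hx => ?_
          linarith [(abs_le.1 (hb x hx)).1]
  · calc _ ≤ ∫ x in (0 : ℝ)..1, (1 - x ^ 2 / 2 + x ^ 4 / 8 - x ^ 6 / 48 + x ^ 8 / 384 -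
          x ^ 10 / 3840 + x ^ 12 * (7 / 276480)) := by
          refine intervalIntegral.integral_mono_on zero_le_one hint
            ((by fun_prop : Continuous _).intervalIntegrable _ _) fun x hx => ?_
          linarith [(abs_le.1 (hb x hx)).2]
      _ ≤ 0.855625 := by
          simp (disch := exact (by fun_prop : Continuous _).intervalIntegrable _ _) only
            [intervalIntegral.integral_sub, intervalIntegral.integral_add,
            intervalIntegral.integral_div, intervalIntegral.integral_mul_const, integral_pow,
            intervalIntegral.integral_const]
          norm_num

theorem abs_stdNormalCDF_one_sub_lt : |stdNormalCDF 1 - 0.8413| < 0.00005 := by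
  have h1 : stdNormalCDF 1 = 1 / 2 + (gaussianReal 0 1).real (Set.Ioc 0 1) := by
    rw [stdNormalCDF, cdf_eq_real, ← gaussianReal_real_Iic_zero,
      ← measureReal_union (Set.Iic_disjoint_Ioc le_rfl) measurableSet_Ioc,
      Set.Iic_union_Ioc_eq_Iic zero_le_one]
  have h2 : (gaussianReal 0 1).real (Set.Ioc 0 1) =
      (√(2 * Real.pi))⁻¹ * ∫ x in (0 : ℝ)..1, Real.exp (-x ^ 2 / 2) := by
    rw [measureReal_def, gaussianReal_apply_eq_integral _ one_ne_zero, ENNReal.toReal_ofReal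
      (integral_nonneg fun _ => gaussianPDFReal_nonneg _ _ _),
      ← intervalIntegral.integral_of_le zero_le_one, ← intervalIntegral.integral_const_mul]
    simp [gaussianPDFReal]
  obtain ⟨hl, hu⟩ := integral_exp_neg_sq_div_two_bounds
  have hs1 : 2.50662 ≤ √(2 * Real.pi) := by
    apply Real.le_sqrt_of_sq_le
    linarith [Real.pi_gt_d6]
  have hs2 : √(2 * Real.pi) ≤ 2.50663 := by
    rw [Real.sqrt_le_left (by norm_num)]
    linarith [Real.pi_lt_d6]
  rw [h1, h2, inv_mul_eq_div]
  set I := ∫ x in (0 : ℝ)..1, Real.exp (-x ^ 2 / 2)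
  have h3 : I / √(2 * Real.pi) ≤ 0.855625 / 2.50662 := by gcongr
  have h4 : 0.85562 / 2.50663 ≤ I / √(2 * Real.pi) := by gcongr
  rw [abs_lt]
  norm_num at h3 h4 ⊢
  constructor <;> linarith

end numerics

end Groupie

theorem theorem1 (p : unitInterval) (hp0 : 0 < p) (hp1 : p < 1) :
    (∀ ε : ℝ, 0 < ε →
      Tendsto
        (fun n : ℕ => SimpleGraph.binomialRandom (Fin n) p
          {G : SimpleGraph (Fin n) |
            ε < |(Groupie.groupieCount G : ℝ) / (n : ℝ) - stdNormalCDF 1|})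
        atTop (𝓝 0)) ∧
    |stdNormalCDF 1 - 0.8413| < 0.00005 := by
  exact ⟨fun _ hε => Groupie.tendsto_binomialRandom_groupieCount hp0 hp1 hε,
    Groupie.abs_stdNormalCDF_one_sub_lt⟩
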